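/- Let $\mathcal H$ be a real Hilbert space, $\mathcal A$ a set of actions (a measurable space), $m\ge 0$ an integer, $\phi_a\in\mathcal H$ ($a\in\mathcal A$) reward features and $M_a:\mathcal H\to\mathbb R^m$ ($a\in\mathcal A$) bounded linear feedback maps with adjoints $M_a^*$, such that the kernel $(a,b)\mapsto k_M(a,b)=M_aM_b^*\in\mathbb R^{m\times m}$ is measurable. Put $f(a)=\langle\phi_a,f\rangle$ for $f\in\mathcal H$, $k_\phi(a,b)=\langle\phi_a,\phi_b\rangle$ and $k_{\phi,M}(a,b)=\phi_aM_b^*\in\mathbb R^{1\times m}$ (the row vector of the functional $x\mapsto\langle\phi_a,M_b^*x\rangle$). Let $\lambda>0$, $\rho\ge 0$, $\delta\in(0,1]$, and let $f^\star\in\mathcal H$ satisfy $\|f^\star\|\le B$. On a probability space let $(a_t)_{t\ge1}$ be random actions and $y_t=M_{a_t}f^\star+\epsilon_t\in\mathbb R^m$ the observations, let $\mathcal F_t=\sigma(a_1,y_1,\dots,a_t,y_t)$, and suppose that the random vector $\epsilon_t$ is conditionally $\rho$-sub-Gaussian given the past and the current action: for all $t\ge1$ and all $u\in\mathbb R^m$,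 $\exp(u^\top\epsilon_t)$ is integrable and $\mathbb E[\exp(u^\top\epsilon_t)\mid\sigma(\mathcal F_{t-1},a_t)]\le\exp(\|u\|^2\rho^2/2)$ almost surely. For $t\ge1$ let $$\hat f_t=\operatorname*{arg\,min}_{f\in\mathcal H}\ \sum_{s=1}^{t-1}\|M_{a_s}f-y_s\|^2+\lambda\|f\|^2,\qquad V_t=\sum_{s=1}^{t-1}M_{a_s}^*M_{a_s}+\lambda I_{\mathcal H},\qquad \|g\|_{V_t}^2=\langle g,V_tg\rangle,$$ $$K_t=[M_{a_r}M_{a_s}^*]_{r,s=1,\dots,t-1}\in\mathbb R^{m(t-1)\times m(t-1)},\qquad k_t(a)=[\phi_aM_{a_s}^*]_{s=1,\dots,t-1}^\top\in\mathbb R^{m(t-1)},$$ $$\beta_{t,\delta}^{1/2}=\rho\sqrt{2\log\tfrac1\delta+\log\det(I+\lambda^{-1}K_t)}+\sqrt\lambda\,B,\qquad \mathcal E_{t,\delta}=\{f\in\mathcal H:\|f-\hat f_t\|_{V_t}^2\le\beta_{t,\delta}\},$$ $$\psi_t(a,b)=\frac1\lambda\Big(\psi(a,b)-(k_t(a)-k_t(b))^\top(K_t+\lambda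 I)^{-1}(k_t(a)-k_t(b))\Big),\qquad \psi(a,b)=k_\phi(a,a)+k_\phi(b,b)-2k_\phi(a,b).$$ Then $\mathbb P[\forall t\ge1:\ f^\star\in\mathcal E_{t,\delta}]\ge1-\delta$. Moreover, on the event $\{\forall t\ge1:\ f^\star\in\mathcal E_{t,\delta}\}$, hence with probability at least $1-\delta$, for all $t\ge1$ and all $a,b\in\mathcal A$, $$|\hat f_t(a)-\hat f_t(b)-(f^\star(a)-f^\star(b))|=|\langle\phi_a-\phi_b,\hat f_t-f^\star\rangle|\le\sqrt{\beta_{t,\delta}\,\psi_t(a,b)}.$$ -/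

import Mathlib

open MeasureTheory
open scoped RealInnerProductSpace

namespace KernelPM

section Deterministic

variable {H A : Type*} [NormedAddCommGroup H] [InnerProductSpace ℝ H] [CompleteSpace H] {m n : ℕ}

/-- The value at the action `a` of the reward function identified with `f`,
for reward features `φ`. -/
noncomputable def reward (φ : A → H) (f : H) (a : A) : ℝ := ⟪φ a, f⟫

/-- Covariance of the reward features of two actions. -/
noncomputable def kPhi (φ : A → H) (a b : A) : ℝ := ⟪φ a, φ b⟫

/-- The `m × m` matrix of the operator `M_a M_b^*` in the standard basis. -/
noncomputable def kM (M : A → H →L[ℝ] EuclideanSpace ℝ (Fin m)) (a b : A) :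
    Matrix (Fin m) (Fin m) ℝ :=
  Matrix.of fun i j =>
    (M a (ContinuousLinearMap.adjoint (M b) (EuclideanSpace.single j 1))) i

/-- The row vector `φ_a M_b^*`. -/
noncomputable def kPhiM (φ : A → H) (M : A → H →L[ℝ] EuclideanSpace ℝ (Fin m)) (a b : A) :
    Fin m → ℝ :=
  fun j => ⟪φ a, ContinuousLinearMap.adjoint (M b) (EuclideanSpace.single j 1)⟫

/-- The kernel metric between two actions. -/
noncomputable def kernelMetric (φ : A → H) (a b : A) : ℝ :=
  kPhi φ a a + kPhi φ b b - 2 * kPhi φ a b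

/-- The kernel matrix of the played actions `h 0, …, h (n - 1)`: an `n × n` block matrix
with `m × m` blocks. -/
noncomputable def kernelMatrix (M : A → H →L[ℝ] EuclideanSpace ℝ (Fin m)) (h : Fin n → A) :
    Matrix (Fin n × Fin m) (Fin n × Fin m) ℝ :=
  Matrix.of fun p q => kM M (h p.1) (h q.1) p.2 q.2

/-- The evaluation weights of the action `a` for the played actions `h`. -/
noncomputable def evalWeights (φ : A → H) (M : A → H →L[ℝ] EuclideanSpace ℝ (Fin m))
    (h : Fin n → A) (a : A) : Fin n × Fin m → ℝ :=
  fun p => kPhiM φ M a (h p.1) p.2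

/-- The kernel expression for the feature uncertainty of the pair `a, b`. -/
noncomputable def featureUncertainty (φ : A → H) (M : A → H →L[ℝ] EuclideanSpace ℝ (Fin m))
    (lam : ℝ) (h : Fin n → A) (a b : A) : ℝ :=
  1 / lam * (kernelMetric φ a b -
    (evalWeights φ M h a - evalWeights φ M h b) ⬝ᵥ
      Matrix.mulVec (kernelMatrix M h + lam • (1 : Matrix (Fin n × Fin m) (Fin n × Fin m) ℝ))⁻¹
        (evalWeights φ M h a - evalWeights φ M h b))

/-- The regularized covariance operator `∑ M_{a_s}^* M_{a_s} + lam I` on `H`. -/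
noncomputable def covOp (M : A → H →L[ℝ] EuclideanSpace ℝ (Fin m)) (lam : ℝ) (h : Fin n → A) :
    H →L[ℝ] H :=
  (∑ s, ContinuousLinearMap.adjoint (M (h s)) ∘L M (h s)) + lam • ContinuousLinearMap.id ℝ H

/-- The regularized least-squares objective for played actions `h` and observations `y`. -/
noncomputable def lsObjective (M : A → H →L[ℝ] EuclideanSpace ℝ (Fin m)) (lam : ℝ)
    (h : Fin n → A) (y : Fin n → EuclideanSpace ℝ (Fin m)) (f : H) : ℝ :=
  (∑ s, ‖M (h s) f - y s‖ ^ 2) + lam * ‖f‖ ^ 2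

/-- The regularized least-squares estimate: the minimizer of the objective over `H`.
For `0 < lam` it exists and is unique, see `existsUnique_minimizer`. -/
noncomputable def lsEstimate (M : A → H →L[ℝ] EuclideanSpace ℝ (Fin m)) (lam : ℝ)
    (h : Fin n → A) (y : Fin n → EuclideanSpace ℝ (Fin m)) : H :=
  Classical.epsilon fun f => IsMinOn (lsObjective M lam h y) Set.univ f

/-- The square root of the confidence coefficient. -/
noncomputable def betaSqrt (M : A → H →L[ℝ] EuclideanSpace ℝ (Fin m)) (lam ρ B δ : ℝ)
    (h : Fin n → A) : ℝ :=
  ρ * Real.sqrt (2 * Real.log (1 / δ) +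
    Real.log (Matrix.det (1 + lam⁻¹ • kernelMatrix M h))) + Real.sqrt lam * B

/-- The confidence coefficient. -/
noncomputable def beta (M : A → H →L[ℝ] EuclideanSpace ℝ (Fin m)) (lam ρ B δ : ℝ)
    (h : Fin n → A) : ℝ :=
  betaSqrt M lam ρ B δ h ^ 2

/-- The confidence set `{f : ‖f - f̂‖_V ^ 2 ≤ β}` in `H`, where `‖g‖_V ^ 2 = ⟨g, V g⟩`. -/
def confSet (M : A → H →L[ℝ] EuclideanSpace ℝ (Fin m)) (lam ρ B δ : ℝ)
    (h : Fin n → A) (y : Fin n → EuclideanSpace ℝ (Fin m)) : Set H :=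
  {f | ⟪f - lsEstimate M lam h y, covOp M lam h (f - lsEstimate M lam h y)⟫
    ≤ beta M lam ρ B δ h}

lemma inner_covOp (M : A → H →L[ℝ] EuclideanSpace ℝ (Fin m)) (lam : ℝ) (h : Fin n → A)
    (g f : H) :
    ⟪g, covOp M lam h f⟫ = (∑ s, ⟪M (h s) g, M (h s) f⟫) + lam * ⟪g, f⟫ := by
  simp [covOp, inner_add_right, inner_sum, ContinuousLinearMap.adjoint_inner_right,
    inner_smul_right]

/-- The normal equation of the least-squares problem has a solution. -/
lemma exists_normalEq (M : A → H →L[ℝ] EuclideanSpace ℝ (Fin m)) {lam : ℝ}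
    (hlam : 0 < lam) (h : Fin n → A) (y : Fin n → EuclideanSpace ℝ (Fin m)) :
    ∃ f₀ : H, ∀ g : H, (∑ s, ⟪M (h s) g, M (h s) f₀ - y s⟫) + lam * ⟪g, f₀⟫ = 0 := by
  have hco : IsCoercive ((innerSL ℝ (E := H)) ∘L covOp M lam h) := by
    refine ⟨lam, hlam, fun u => ?_⟩
    have e : ((innerSL ℝ (E := H)) ∘L covOp M lam h) u u = ⟪u, covOp M lam h u⟫ :=
      real_inner_comm _ _
    rw [e, inner_covOp, real_inner_self_eq_norm_mul_norm]
    have : 0 ≤ ∑ s, ⟪M (h s) u, M (h s) u⟫ :=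
      Finset.sum_nonneg fun s _ => real_inner_self_nonneg
    linarith
  let b : H := ∑ s, ContinuousLinearMap.adjoint (M (h s)) (y s)
  refine ⟨hco.continuousLinearEquivOfBilin.symm b, fun g => ?_⟩
  set f₀ := hco.continuousLinearEquivOfBilin.symm b with hf
  have h1 := hco.continuousLinearEquivOfBilin_apply f₀ g
  rw [hf, ContinuousLinearEquiv.apply_symm_apply, ← hf] at h1
  have h2 : ⟪g, b⟫ = ⟪g, covOp M lam h f₀⟫ := by
    rw [real_inner_comm, h1]
    exact real_inner_comm _ _
  rw [inner_covOp] at h2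
  have h3 : ⟪g, b⟫ = ∑ s, ⟪M (h s) g, y s⟫ := by
    simp [b, inner_sum, ContinuousLinearMap.adjoint_inner_right]
  simp only [inner_sub_right, Finset.sum_sub_distrib]
  linarith

/-- For `0 < lam` the least-squares objective has exactly one minimizer. -/
theorem existsUnique_minimizer (M : A → H →L[ℝ] EuclideanSpace ℝ (Fin m)) {lam : ℝ}
    (hlam : 0 < lam) (h : Fin n → A) (y : Fin n → EuclideanSpace ℝ (Fin m)) :
    ∃! f, IsMinOn (lsObjective M lam h y) Set.univ f := by
  obtain ⟨f₀, hf₀⟩ := exists_normalEq M hlam h y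
  have key : ∀ g, lsObjective M lam h y g = lsObjective M lam h y f₀ +
      ((∑ s, ‖M (h s) (g - f₀)‖ ^ 2) + lam * ‖g - f₀‖ ^ 2) := by
    intro g
    have h1 : ∀ s, ‖M (h s) g - y s‖ ^ 2 = ‖M (h s) f₀ - y s‖ ^ 2 +
        2 * ⟪M (h s) (g - f₀), M (h s) f₀ - y s⟫ + ‖M (h s) (g - f₀)‖ ^ 2 := by
      intro s
      have e : M (h s) g - y s = (M (h s) f₀ - y s) + M (h s) (g - f₀) := by
        rw [map_sub]; abel
      rw [e, norm_add_sq_real, real_inner_comm]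
    have h2 : ‖g‖ ^ 2 = ‖f₀‖ ^ 2 + 2 * ⟪g - f₀, f₀⟫ + ‖g - f₀‖ ^ 2 := by
      have e : g = f₀ + (g - f₀) := by abel
      conv_lhs => rw [e]
      rw [norm_add_sq_real, real_inner_comm]
    have h3 := hf₀ (g - f₀)
    simp only [lsObjective, h1, h2, Finset.sum_add_distrib, ← Finset.mul_sum]
    linear_combination 2 * h3
  have hs : ∀ g, 0 ≤ ∑ s, ‖M (h s) (g - f₀)‖ ^ 2 := fun g =>
    Finset.sum_nonneg fun s _ => sq_nonneg _
  refine ⟨f₀, fun g _ => ?_, fun g hg => ?_⟩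
  · have := hs g
    have h4 : 0 ≤ lam * ‖g - f₀‖ ^ 2 := by positivity
    have h5 := key g
    change lsObjective M lam h y f₀ ≤ lsObjective M lam h y g
    linarith
  · have h4 : lsObjective M lam h y g ≤ lsObjective M lam h y f₀ := hg (Set.mem_univ f₀)
    have h5 := key g
    have h6 := hs g
    have h7 : lam * ‖g - f₀‖ ^ 2 ≤ 0 := by linarith
    have h8 : ‖g - f₀‖ ^ 2 ≤ 0 := by
      by_contra hc
      push Not at hc
      have := mul_pos hlam hc
      linarith
    have h9 : ‖g - f₀‖ = 0 := by
      have := sq_nonneg ‖g - f₀‖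
      exact pow_eq_zero_iff (two_ne_zero) |>.1 (le_antisymm h8 this)
    exact sub_eq_zero.1 (norm_eq_zero.1 h9)

theorem lsEstimate_isMinOn (M : A → H →L[ℝ] EuclideanSpace ℝ (Fin m)) {lam : ℝ}
    (hlam : 0 < lam) (h : Fin n → A) (y : Fin n → EuclideanSpace ℝ (Fin m)) :
    IsMinOn (lsObjective M lam h y) Set.univ (lsEstimate M lam h y) :=
  Classical.epsilon_spec (p := fun f => IsMinOn (lsObjective M lam h y) Set.univ f)
    (existsUnique_minimizer M hlam h y).exists

end Deterministic

section Stochastic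

variable {Ω A : Type*} {m : ℕ}

/-- The σ-algebra generated by the first `n` actions and observations. -/
@[reducible] def history [MeasurableSpace A] (a : ℕ → Ω → A) (y : ℕ → Ω → EuclideanSpace ℝ (Fin m)) (n : ℕ) :
    MeasurableSpace Ω :=
  ⨆ s : Fin n, (MeasurableSpace.comap (a s) inferInstance ⊔
    MeasurableSpace.comap (y s) inferInstance)

/-- The history of the first `n` rounds together with the action of the next round. -/
@[reducible] def historyWithAction [MeasurableSpace A] (a : ℕ → Ω → A)
    (y : ℕ → Ω → EuclideanSpace ℝ (Fin m)) (n : ℕ) : MeasurableSpace Ω :=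
  history a y n ⊔ MeasurableSpace.comap (a n) inferInstance

/-- The random vector `ε` is conditionally `ρ`-sub-Gaussian given the σ-algebra `G`. The
integrability clause says that the conditional expectation is a genuine one. -/
def CondSubGaussian [MeasurableSpace Ω] (μ : Measure Ω) (G : MeasurableSpace Ω) (ρ : ℝ)
    (ε : Ω → EuclideanSpace ℝ (Fin m)) : Prop :=
  ∀ u : EuclideanSpace ℝ (Fin m),
    Integrable (fun ω => Real.exp ⟪u, ε ω⟫) μ ∧
    ∀ᵐ ω ∂μ, (μ[fun ω' => Real.exp ⟪u, ε ω'⟫ | G]) ω ≤ Real.exp (‖u‖ ^ 2 * ρ ^ 2 / 2)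

end Stochastic

end KernelPM

/-! For the stacked noise $x$, `noiseForm` is $x^\top x-x^\top(I+\lambda^{-1}K)^{-1}x$, the squared
$V^{-1}$-norm of $\sum_s M_{a_s}^*\epsilon_s$. The normal equation and Cauchy–Schwarz for the
$V$-form therefore give $\|f^\star-\hat f\|_V\le\sqrt{\texttt{noiseForm}}+\sqrt\lambda\,B$
(`sqrt_covOp_error_le`), and the first claim reduces to bounding `noiseForm` in all rounds at once.

After division of the noise by $\rho$, $\exp(\texttt{noiseForm}/2)/\sqrt{\det(I+\lambda^{-1}K)}$ is
the likelihood ratio of $N(0,I+\lambda^{-1}K)$ to $N(0,I)$, called `noiseRatio`. It is a nonnegative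
supermartingale started at 1, so Ville's inequality (`mul_measure_exists_gt_le`) at level $1/\delta$
gives the uniform bound. No Gaussian measure on $H$ is needed: a Schur complement splits off the
last round as the ratio of $N(c,S)$ to $N(0,I)$ on $\mathbb R^m$, with conditional mean $c$ and
covariance $S\ge I$ known before the new noise (`noiseRatio_succ`). For invertible $S-I$ this factor
is the average of $\exp(z^\top x-|z|^2/2)$ over $z\sim N(c,S-I)$, and each such exponential has
conditional expectation at most 1; a limit covers singular $S-I$ (`lintegral_mul_gaussRatio_le`). If
$\rho=0$ the noise vanishes almost surely.

The bound for pairs of actions is Cauchy–Schwarz against $V^{-1}(\phi_b-\phi_c)$, whose squared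
$V$-norm is the kernel expression $\psi_t$ (`abs_inner_feature_le`). -/

namespace KernelPM

/-! ### Measurability of determinants, inverses and products of random matrices -/

section MatrixMeasurability

variable {Ω ι κ : Type*} [Fintype ι] {G : MeasurableSpace Ω}

lemma measurable_det [DecidableEq ι] {S : Ω → Matrix ι ι ℝ}
    (hS : ∀ i j, Measurable[G] fun ω => S ω i j) : Measurable[G] fun ω => (S ω).det := by
  simp only [Matrix.det_apply]
  exact Finset.measurable_sum _ fun σ _ =>
    (Finset.measurable_prod _ fun i _ => hS _ _).const_smul _

/-- Cramer's rule expresses the entries through determinants. The convention that a singular matrix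
has inverse zero makes this valid at every point. -/
lemma measurable_inv_entry [DecidableEq ι] {S : Ω → Matrix ι ι ℝ}
    (hS : ∀ i j, Measurable[G] fun ω => S ω i j) (i j : ι) :
    Measurable[G] fun ω => (S ω)⁻¹ i j := by
  simp only [Matrix.inv_def, Ring.inverse_eq_inv', Matrix.smul_apply, smul_eq_mul,
    Matrix.adjugate_apply]
  refine (measurable_det hS).inv.mul (measurable_det fun k l => ?_)
  by_cases hk : k = j
  · subst hk
    simp only [Matrix.updateRow_self]
    exact measurable_const
  · simp only [Matrix.updateRow_ne hk]
    exact hS k l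

lemma measurable_dotProduct {u v : Ω → ι → ℝ} (hu : ∀ i, Measurable[G] fun ω => u ω i)
    (hv : ∀ i, Measurable[G] fun ω => v ω i) : Measurable[G] fun ω => u ω ⬝ᵥ v ω :=
  Finset.measurable_sum _ fun i _ => (hu i).mul (hv i)

lemma measurable_mulVec_entry {S : Ω → Matrix κ ι ℝ} {v : Ω → ι → ℝ}
    (hS : ∀ i j, Measurable[G] fun ω => S ω i j) (hv : ∀ i, Measurable[G] fun ω => v ω i)
    (k : κ) : Measurable[G] fun ω => (S ω).mulVec (v ω) k :=
  measurable_dotProduct (hS k) hv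

end MatrixMeasurability

/-! ### Gaussian integrals and likelihood ratios on a finite-dimensional space -/

section GaussianIntegral

variable {ι : Type*} [Fintype ι]

/-- The mass of the unnormalized standard Gaussian density. -/
noncomputable def gaussMass (ι : Type*) [Fintype ι] : ENNReal :=
  ∫⁻ z : ι → ℝ, ENNReal.ofReal (Real.exp (-(z ⬝ᵥ z) / 2))

/-- The value of this constant is irrelevant: it occurs on both sides of the mixture inequality and
cancels once it is known to be finite and nonzero. -/
lemma gaussMass_ne_top : gaussMass ι ≠ ⊤ := by
  have h : Integrable (fun z : ι → ℝ => ∏ i, Real.exp (-(1 / 2) * z i ^ 2)) :=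
    Integrable.fintype_prod (f := fun _ (v : ℝ) => Real.exp (-(1 / 2) * v ^ 2))
      fun _ => integrable_exp_neg_mul_sq (by norm_num)
  have e : (fun z : ι → ℝ => ∏ i, Real.exp (-(1 / 2) * z i ^ 2)) =
      fun z => Real.exp (-(z ⬝ᵥ z) / 2) := by
    ext z
    rw [← Real.exp_sum, ← Finset.mul_sum]
    simp only [dotProduct, pow_two]
    congr 1
    ring
  rw [e] at h
  exact h.lintegral_lt_top.ne

lemma gaussMass_ne_zero : gaussMass ι ≠ 0 := by
  unfold gaussMass
  rw [Ne, lintegral_eq_zero_iff (by fun_prop)]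
  intro h
  have h2 : ∀ᵐ z : ι → ℝ, False := by
    filter_upwards [h] with z hz
    simp only [Pi.zero_apply, ENNReal.ofReal_eq_zero] at hz
    exact absurd hz (not_le.2 (Real.exp_pos _))
  rw [Filter.eventually_false_iff_eq_bot, ae_eq_bot] at h2
  exact NeZero.ne (volume : Measure (ι → ℝ)) h2

variable [DecidableEq ι]

lemma exists_transpose_mul_self {Q : Matrix ι ι ℝ} (hQ : Q.PosSemidef) :
    ∃ B : Matrix ι ι ℝ, Q = B.transpose * B := by
  open scoped MatrixOrder in
  obtain ⟨B, hB⟩ := CStarAlgebra.nonneg_iff_eq_star_mul_self.1 hQ.nonneg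
  exact ⟨B, by rw [hB, Matrix.star_eq_conjTranspose, Matrix.conjTranspose_eq_transpose_of_trivial]⟩

/-- Translate by $z_0$, factor $Q=B^\top B$ and substitute $w=Bz$, with Jacobian $|\det
B|=\sqrt{\det Q}$. -/
lemma lintegral_exp_neg_quadratic {Q : Matrix ι ι ℝ} (hQ : Q.PosDef) (z₀ : ι → ℝ) :
    ∫⁻ z : ι → ℝ, ENNReal.ofReal (Real.exp (-((z - z₀) ⬝ᵥ Q.mulVec (z - z₀)) / 2)) =
      ENNReal.ofReal (Real.sqrt Q.det)⁻¹ * gaussMass ι := by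
  obtain ⟨B, hB⟩ := exists_transpose_mul_self hQ.posSemidef
  have hdet : Q.det = B.det ^ 2 := by rw [hB, Matrix.det_mul, Matrix.det_transpose, sq]
  have hB0 : B.det ≠ 0 := fun h => by
    have := hQ.det_pos
    rw [hdet, h] at this
    simp at this
  rw [lintegral_sub_right_eq_self
    (fun z : ι → ℝ => ENNReal.ofReal (Real.exp (-(z ⬝ᵥ Q.mulVec z) / 2))) z₀]
  have e : ∀ z : ι → ℝ, z ⬝ᵥ Q.mulVec z = Matrix.toLin' B z ⬝ᵥ Matrix.toLin' B z := by
    intro z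
    rw [Matrix.toLin'_apply, hB, ← Matrix.mulVec_mulVec, Matrix.dotProduct_mulVec,
      Matrix.vecMul_transpose]
  simp only [e]
  have hmeas : Measurable (Matrix.toLin' B) :=
    (LinearMap.continuous_of_finiteDimensional _).measurable
  have := lintegral_map (μ := (volume : Measure (ι → ℝ)))
    (f := fun w : ι → ℝ => ENNReal.ofReal (Real.exp (-(w ⬝ᵥ w) / 2))) (by fun_prop) hmeas
  rw [← this, Real.map_matrix_volume_pi_eq_smul_volume_pi hB0, lintegral_smul_measure, hdet,
    Real.sqrt_sq_eq_abs, abs_inv]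
  rfl

/-- The unnormalized density at `z` of the Gaussian with mean `c` and covariance `P`. -/
noncomputable def gaussDensity (P : Matrix ι ι ℝ) (c z : ι → ℝ) : ℝ :=
  (Real.sqrt P.det)⁻¹ * Real.exp (-((z - c) ⬝ᵥ P⁻¹.mulVec (z - c)) / 2)

/-- The density at `x` of the Gaussian with mean `c` and covariance `S` relative to the standard
Gaussian. -/
noncomputable def gaussRatio (S : Matrix ι ι ℝ) (c x : ι → ℝ) : ℝ :=
  Real.exp ((x ⬝ᵥ x - (x - c) ⬝ᵥ S⁻¹.mulVec (x - c)) / 2) / Real.sqrt S.det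

lemma gaussDensity_nonneg (P : Matrix ι ι ℝ) (c z : ι → ℝ) : 0 ≤ gaussDensity P c z := by
  unfold gaussDensity
  positivity

lemma gaussRatio_nonneg (S : Matrix ι ι ℝ) (c x : ι → ℝ) : 0 ≤ gaussRatio S c x := by
  unfold gaussRatio
  positivity

lemma lintegral_gaussDensity {P : Matrix ι ι ℝ} (hP : P.PosDef) (c : ι → ℝ) :
    ∫⁻ z, ENNReal.ofReal (gaussDensity P c z) = gaussMass ι := by
  have h0 : 0 < Real.sqrt P.det := Real.sqrt_pos.2 hP.det_pos
  simp only [gaussDensity, ENNReal.ofReal_mul (inv_nonneg.2 h0.le)]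
  rw [lintegral_const_mul _ (by simp only [Matrix.mulVec, dotProduct]; fun_prop),
    lintegral_exp_neg_quadratic hP.inv,
    ← mul_assoc, ← ENNReal.ofReal_mul (inv_nonneg.2 h0.le), Matrix.det_nonsing_inv,
    Ring.inverse_eq_inv', Real.sqrt_inv, inv_inv, inv_mul_cancel₀ h0.ne', ENNReal.ofReal_one,
    one_mul]

/-- Tilting $N(c,P)$ by $\exp(z^\top x-|z|^2/2)$ gives a Gaussian in $z$ with precision $P^{-1}+1$
and mean $x-(P+1)^{-1}(x-c)$. -/
lemma complete_square {P : Matrix ι ι ℝ} (hP : P.PosDef) (c x z : ι → ℝ) :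
    -((z - c) ⬝ᵥ P⁻¹.mulVec (z - c)) / 2 + (z ⬝ᵥ x - z ⬝ᵥ z / 2) =
      (x ⬝ᵥ x - (x - c) ⬝ᵥ (P + 1)⁻¹.mulVec (x - c)) / 2 +
      -((z - (x - (P + 1)⁻¹.mulVec (x - c))) ⬝ᵥ
        (P⁻¹ + 1).mulVec (z - (x - (P + 1)⁻¹.mulVec (x - c)))) / 2 := by
  have hS : (P + 1).PosDef := hP.add Matrix.PosDef.one
  have hPd : IsUnit P.det := hP.det_pos.ne'.isUnit
  have hSd : IsUnit (P + 1).det := hS.det_pos.ne'.isUnit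
  set w := (P + 1)⁻¹.mulVec (x - c) with hw
  have h1 : P.mulVec w + w = x - c := by
    have : (P + 1).mulVec w = x - c := by
      rw [hw, Matrix.mulVec_mulVec, Matrix.mul_nonsing_inv _ hSd, Matrix.one_mulVec]
    rwa [Matrix.add_mulVec, Matrix.one_mulVec] at this
  set v := P.mulVec w with hv
  have h2 : P⁻¹.mulVec v = w := by
    rw [hv, Matrix.mulVec_mulVec, Matrix.nonsing_inv_mul _ hPd, Matrix.one_mulVec]
  obtain ⟨r, rfl⟩ : ∃ r, z = r + (x - w) := ⟨z - (x - w), by abel⟩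
  have e1 : r + (x - w) - c = r + v := by
    have : x = v + w + c := by rw [h1]; abel
    rw [this]; abel
  have hsymm : v ⬝ᵥ P⁻¹.mulVec r = r ⬝ᵥ w := by
    rw [Matrix.dotProduct_mulVec, ← Matrix.mulVec_transpose]
    have : P⁻¹.transpose = P⁻¹ := by
      have := hP.inv.isHermitian.eq
      rwa [Matrix.conjTranspose_eq_transpose_of_trivial] at this
    rw [this, h2, dotProduct_comm]
  rw [e1, add_sub_cancel_right, ← h1]
  simp only [Matrix.mulVec_add, Matrix.add_mulVec, Matrix.one_mulVec, h2, add_dotProduct,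
    dotProduct_add, sub_dotProduct, dotProduct_sub, hsymm]
  rw [dotProduct_comm x r, dotProduct_comm w r, dotProduct_comm x w]
  ring

/-- The exponential is the ratio of $N(z,I)$ to $N(0,I)$ at $x$; averaging $N(z,I)$ over $z\sim
N(c,P)$ gives $N(c,P+I)$. -/
lemma lintegral_gaussDensity_mul_exp {P : Matrix ι ι ℝ} (hP : P.PosDef) (c x : ι → ℝ) :
    ∫⁻ z, ENNReal.ofReal (gaussDensity P c z) *
        ENNReal.ofReal (Real.exp (z ⬝ᵥ x - z ⬝ᵥ z / 2)) =
      gaussMass ι * ENNReal.ofReal (gaussRatio (P + 1) c x) := by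
  have hS : (P + 1).PosDef := hP.add Matrix.PosDef.one
  have h0 : 0 < Real.sqrt P.det := Real.sqrt_pos.2 hP.det_pos
  set b := Real.exp ((x ⬝ᵥ x - (x - c) ⬝ᵥ (P + 1)⁻¹.mulVec (x - c)) / 2) with hb
  have hb0 : 0 ≤ (Real.sqrt P.det)⁻¹ * b := by positivity
  have e : ∀ z, ENNReal.ofReal (gaussDensity P c z) *
        ENNReal.ofReal (Real.exp (z ⬝ᵥ x - z ⬝ᵥ z / 2)) =
      ENNReal.ofReal ((Real.sqrt P.det)⁻¹ * b) * ENNReal.ofReal (Real.exp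
        (-((z - (x - (P + 1)⁻¹.mulVec (x - c))) ⬝ᵥ
        (P⁻¹ + 1).mulVec (z - (x - (P + 1)⁻¹.mulVec (x - c)))) / 2)) := by
    intro z
    rw [← ENNReal.ofReal_mul (gaussDensity_nonneg _ _ _), ← ENNReal.ofReal_mul hb0,
      gaussDensity, mul_assoc, ← Real.exp_add, complete_square hP, Real.exp_add, mul_assoc]
  have hQ : (P⁻¹ + 1).PosDef := hP.inv.add Matrix.PosDef.one
  simp only [e]
  rw [lintegral_const_mul _ (by simp only [Matrix.mulVec, dotProduct]; fun_prop),
    lintegral_exp_neg_quadratic hQ, ← mul_assoc, ← ENNReal.ofReal_mul hb0, mul_comm, gaussRatio,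
    ← hb]
  congr 2
  have hd : (P + 1).det = P.det * (P⁻¹ + 1).det := by
    rw [← Matrix.det_mul, mul_add, Matrix.mul_nonsing_inv _ hP.det_pos.ne'.isUnit, mul_one,
      add_comm]
  rw [hd, Real.sqrt_mul hP.det_pos.le, div_eq_mul_inv, mul_inv]
  ring

lemma tendsto_gaussRatio {S : Matrix ι ι ℝ} (hS : S.PosDef) (c x : ι → ℝ) {u : ℕ → ℝ}
    (hu : Filter.Tendsto u Filter.atTop (nhds 0)) :
    Filter.Tendsto (fun k => gaussRatio (S + u k • (1 : Matrix ι ι ℝ)) c x) Filter.atTop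
      (nhds (gaussRatio S c x)) := by
  have hcont : Continuous fun r : ℝ => S + r • (1 : Matrix ι ι ℝ) := by fun_prop
  have hdet : Continuous fun r : ℝ => (S + r • (1 : Matrix ι ι ℝ)).det := hcont.matrix_det
  have h0 : (S + (0 : ℝ) • (1 : Matrix ι ι ℝ)) = S := by simp
  have hd0 : (S + (0 : ℝ) • (1 : Matrix ι ι ℝ)).det ≠ 0 := by rw [h0]; exact hS.det_pos.ne'
  have hinv : ContinuousAt (fun r : ℝ => (S + r • (1 : Matrix ι ι ℝ))⁻¹) 0 := by
    simp only [Matrix.inv_def, Ring.inverse_eq_inv']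
    exact (hdet.continuousAt.inv₀ hd0).smul hcont.matrix_adjugate.continuousAt
  have hq : ContinuousAt (fun r : ℝ =>
      (x - c) ⬝ᵥ (S + r • (1 : Matrix ι ι ℝ))⁻¹.mulVec (x - c)) 0 := by
    have : Continuous fun T : Matrix ι ι ℝ => (x - c) ⬝ᵥ T.mulVec (x - c) :=
      continuous_const.dotProduct (continuous_id.matrix_mulVec continuous_const)
    exact ContinuousAt.comp (g := fun T : Matrix ι ι ℝ => (x - c) ⬝ᵥ T.mulVec (x - c))
      this.continuousAt hinv
  have hr : ContinuousAt (fun r : ℝ => gaussRatio (S + r • (1 : Matrix ι ι ℝ)) c x) 0 := by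
    unfold gaussRatio
    refine ContinuousAt.div ?_ (hdet.sqrt.continuousAt) ?_
    · exact ((continuousAt_const.sub hq).div_const 2).rexp
    · rw [h0]; exact (Real.sqrt_pos.2 hS.det_pos).ne'
  have := hr.tendsto.comp hu
  rwa [h0] at this

end GaussianIntegral

/-! ### One round: the conditional expectation of a Gaussian ratio is at most 1 -/

section ConditionalStep

variable {Ω ι : Type*} [Fintype ι] {G m0 : MeasurableSpace Ω} {μ : Measure Ω}

/-- The weight $Y$ may be infinite or non-integrable, so it is not pulled out of a conditional
expectation. Instead the measures $X\mu$ and $c\mu$ are compared on `G`, and $Y$ is integrated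
against both. -/
lemma lintegral_mul_le_of_condExp_le [IsFiniteMeasure μ] (hG : G ≤ m0) {X : Ω → ℝ}
    (hX0 : ∀ ω, 0 ≤ X ω) (hX : Integrable X μ) {c : ℝ}
    (hc : ∀ᵐ ω ∂μ, (μ[X | G]) ω ≤ c) {Y : Ω → ENNReal} (hY : Measurable[G] Y) :
    ∫⁻ ω, Y ω * ENNReal.ofReal (X ω) ∂μ ≤ ENNReal.ofReal c * ∫⁻ ω, Y ω ∂μ := by
  set ν := μ.withDensity fun ω => ENNReal.ofReal (X ω) with hν
  have hle : ν.trim hG ≤ ENNReal.ofReal c • μ.trim hG := by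
    refine @Measure.le_iff Ω G _ _ |>.2 fun s hs => ?_
    rw [Measure.smul_apply, trim_measurableSet_eq hG hs, trim_measurableSet_eq hG hs, hν,
      withDensity_apply _ (hG s hs),
      ← ofReal_integral_eq_lintegral_ofReal hX.integrableOn (Filter.Eventually.of_forall hX0),
      ← setIntegral_condExp hG hX hs]
    have h1 : ∫ ω in s, (μ[X | G]) ω ∂μ ≤ ∫ _ in s, c ∂μ :=
      setIntegral_mono_ae integrable_condExp.integrableOn (integrable_const c) hc
    rw [setIntegral_const, smul_eq_mul] at h1
    refine (ENNReal.ofReal_le_ofReal h1).trans ?_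
    rw [ENNReal.ofReal_mul measureReal_nonneg, mul_comm, ofReal_measureReal, smul_eq_mul]
  have h1 : ∫⁻ ω, Y ω * ENNReal.ofReal (X ω) ∂μ = ∫⁻ ω, Y ω ∂ν := by
    rw [hν, lintegral_withDensity_eq_lintegral_mul₀ hX.aestronglyMeasurable.aemeasurable.ennreal_ofReal
      (hY.mono hG le_rfl).aemeasurable]
    simp only [Pi.mul_apply, mul_comm]
  rw [h1, ← lintegral_trim hG hY, ← lintegral_trim hG hY, ← smul_eq_mul,
    ← lintegral_smul_measure]
  exact lintegral_mono' hle le_rfl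

/-- The vector `x` is conditionally `1`-sub-Gaussian given `G`. -/
def StdSubGaussian {m0 : MeasurableSpace Ω} (μ : Measure Ω) (G : MeasurableSpace Ω)
    (x : Ω → ι → ℝ) : Prop :=
  ∀ u : ι → ℝ, Integrable (fun ω => Real.exp (u ⬝ᵥ x ω)) μ ∧
    ∀ᵐ ω ∂μ, (μ[fun ω' => Real.exp (u ⬝ᵥ x ω') | G]) ω ≤ Real.exp (u ⬝ᵥ u / 2)

/-- Tonelli: the inequality for each fixed $z$ is integrated over $z$. -/
lemma lintegral_mul_mixture_le {α : Type*} [MeasurableSpace α] {ν : Measure α} [SFinite ν]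
    [SFinite μ] {Y : Ω → ENNReal} (hY : Measurable Y) {p e : Ω → α → ENNReal}
    (hp : Measurable (Function.uncurry p)) (he : Measurable (Function.uncurry e))
    (h : ∀ z, ∫⁻ ω, Y ω * p ω z * e ω z ∂μ ≤ ∫⁻ ω, Y ω * p ω z ∂μ) :
    ∫⁻ ω, Y ω * (∫⁻ z, p ω z * e ω z ∂ν) ∂μ ≤ ∫⁻ ω, Y ω * (∫⁻ z, p ω z ∂ν) ∂μ := by
  have hYm : Measurable fun q : Ω × α => Y q.1 := hY.comp measurable_fst
  have h1 : ∀ ω, Y ω * (∫⁻ z, p ω z * e ω z ∂ν) = ∫⁻ z, Y ω * p ω z * e ω z ∂ν := by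
    intro ω
    simp only [mul_assoc]
    exact (lintegral_const_mul _ ((hp.comp measurable_prodMk_left).mul
      (he.comp measurable_prodMk_left))).symm
  have h2 : ∀ ω, Y ω * (∫⁻ z, p ω z ∂ν) = ∫⁻ z, Y ω * p ω z ∂ν := fun ω =>
    (lintegral_const_mul _ (hp.comp measurable_prodMk_left)).symm
  simp only [h1, h2]
  rw [lintegral_lintegral_swap ((hYm.mul hp).mul he).aemeasurable,
    lintegral_lintegral_swap (μ := μ) (f := fun ω z => Y ω * p ω z) (hYm.mul hp).aemeasurable]
  exact lintegral_mono h

lemma StdSubGaussian.lintegral_le [IsFiniteMeasure μ] (hG : G ≤ m0) {x : Ω → ι → ℝ}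
    (hx : StdSubGaussian μ G x) {Y : Ω → ENNReal} (hY : Measurable[G] Y) (z : ι → ℝ) :
    ∫⁻ ω, Y ω * ENNReal.ofReal (Real.exp (z ⬝ᵥ x ω - z ⬝ᵥ z / 2)) ∂μ ≤ ∫⁻ ω, Y ω ∂μ := by
  have h := lintegral_mul_le_of_condExp_le hG (fun ω => (Real.exp_pos _).le) (hx z).1
    (hx z).2 hY
  have e : ∀ ω, Y ω * ENNReal.ofReal (Real.exp (z ⬝ᵥ x ω - z ⬝ᵥ z / 2)) =
      ENNReal.ofReal (Real.exp (-(z ⬝ᵥ z / 2))) *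
        (Y ω * ENNReal.ofReal (Real.exp (z ⬝ᵥ x ω))) := by
    intro ω
    rw [sub_eq_add_neg, Real.exp_add, ENNReal.ofReal_mul (Real.exp_pos _).le]
    ring
  simp only [e]
  rw [lintegral_const_mul' _ _ ENNReal.ofReal_ne_top]
  refine (mul_le_mul_right h _).trans ?_
  rw [← mul_assoc, ← ENNReal.ofReal_mul (Real.exp_pos _).le, ← Real.exp_add, neg_add_cancel,
    Real.exp_zero, ENNReal.ofReal_one, one_mul]

variable [DecidableEq ι]

lemma measurable_gaussDensity {P : Ω → Matrix ι ι ℝ} {c z : Ω → ι → ℝ}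
    (hP : ∀ i j, Measurable[G] fun ω => P ω i j) (hc : ∀ i, Measurable[G] fun ω => c ω i)
    (hz : ∀ i, Measurable[G] fun ω => z ω i) :
    Measurable[G] fun ω => gaussDensity (P ω) (c ω) (z ω) := by
  unfold gaussDensity
  have hzc : ∀ i, Measurable[G] fun ω => (z ω - c ω) i := fun i => (hz i).sub (hc i)
  exact (measurable_det hP).sqrt.inv.mul ((measurable_dotProduct hzc
    (measurable_mulVec_entry (measurable_inv_entry hP) hzc)).neg.div_const 2).exp

lemma measurable_gaussRatio {S : Ω → Matrix ι ι ℝ} {c x : Ω → ι → ℝ}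
    (hS : ∀ i j, Measurable[G] fun ω => S ω i j) (hc : ∀ i, Measurable[G] fun ω => c ω i)
    (hx : ∀ i, Measurable[G] fun ω => x ω i) :
    Measurable[G] fun ω => gaussRatio (S ω) (c ω) (x ω) := by
  unfold gaussRatio
  have hxc : ∀ i, Measurable[G] fun ω => (x ω - c ω) i := fun i => (hx i).sub (hc i)
  exact (((measurable_dotProduct hx hx).sub (measurable_dotProduct hxc
    (measurable_mulVec_entry (measurable_inv_entry hS) hxc))).div_const 2).exp.div
      (measurable_det hS).sqrt

lemma lintegral_mul_gaussRatio_le_of_posDef [IsFiniteMeasure μ] (hG : G ≤ m0) {x : Ω → ι → ℝ}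
    (hxm : ∀ i, Measurable fun ω => x ω i) (hx : StdSubGaussian μ G x)
    {Y : Ω → ENNReal} (hY : Measurable[G] Y) {P : Ω → Matrix ι ι ℝ} {c : Ω → ι → ℝ}
    (hP : ∀ i j, Measurable[G] fun ω => P ω i j) (hc : ∀ i, Measurable[G] fun ω => c ω i)
    (hpos : ∀ ω, (P ω).PosDef) :
    ∫⁻ ω, Y ω * ENNReal.ofReal (gaussRatio (P ω + 1) (c ω) (x ω)) ∂μ ≤ ∫⁻ ω, Y ω ∂μ := by
  have hfst : ∀ {f : Ω → ℝ}, Measurable f → Measurable fun p : Ω × (ι → ℝ) => f p.1 :=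
    fun hf => hf.comp measurable_fst
  have hsnd : ∀ i, Measurable fun p : Ω × (ι → ℝ) => p.2 i :=
    fun i => (measurable_pi_apply i).comp measurable_snd
  have hpm : Measurable fun p : Ω × (ι → ℝ) => gaussDensity (P p.1) (c p.1) p.2 :=
    measurable_gaussDensity (fun i j => hfst ((hP i j).mono hG le_rfl))
      (fun i => hfst ((hc i).mono hG le_rfl)) hsnd
  have hem : Measurable fun p : Ω × (ι → ℝ) => Real.exp (p.2 ⬝ᵥ x p.1 - p.2 ⬝ᵥ p.2 / 2) :=
    ((measurable_dotProduct hsnd fun i => hfst (hxm i)).sub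
      ((measurable_dotProduct hsnd hsnd).div_const 2)).exp
  have hp' : Measurable (Function.uncurry fun ω z =>
      ENNReal.ofReal (gaussDensity (P ω) (c ω) z)) := hpm.ennreal_ofReal
  have he' : Measurable (Function.uncurry fun ω (z : ι → ℝ) =>
      ENNReal.ofReal (Real.exp (z ⬝ᵥ x ω - z ⬝ᵥ z / 2))) := hem.ennreal_ofReal
  -- For fixed $z$ the mixing density is random but `G`-measurable, so it can be absorbed into the
  -- weight and the sub-Gaussian bound applied at $z$.
  have hYp : ∀ z, Measurable[G] fun ω => Y ω * ENNReal.ofReal (gaussDensity (P ω) (c ω) z) :=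
    fun z => hY.mul (measurable_gaussDensity (z := fun _ => z) hP hc
      fun i => measurable_const).ennreal_ofReal
  have h := lintegral_mul_mixture_le (ν := (volume : Measure (ι → ℝ))) (hY.mono hG le_rfl)
    hp' he' fun z => hx.lintegral_le hG (hYp z) z
  have e₁ : ∀ ω, Y ω * (∫⁻ z, ENNReal.ofReal (gaussDensity (P ω) (c ω) z) *
      ENNReal.ofReal (Real.exp (z ⬝ᵥ x ω - z ⬝ᵥ z / 2))) =
      gaussMass ι * (Y ω * ENNReal.ofReal (gaussRatio (P ω + 1) (c ω) (x ω))) := fun ω => by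
    rw [lintegral_gaussDensity_mul_exp (hpos ω), mul_left_comm]
  have e₂ : ∀ ω, Y ω * (∫⁻ z, ENNReal.ofReal (gaussDensity (P ω) (c ω) z)) =
      gaussMass ι * Y ω := fun ω => by
    rw [lintegral_gaussDensity (hpos ω), mul_comm]
  rw [lintegral_congr e₁, lintegral_congr e₂, lintegral_const_mul' _ _ gaussMass_ne_top,
    lintegral_const_mul' _ _ gaussMass_ne_top] at h
  exact (ENNReal.mul_le_mul_iff_right gaussMass_ne_zero gaussMass_ne_top).1 h

/-- Here $S-1$ may be singular, so $N(c,S-1)$ need not have a density. The nondegenerate case is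
applied to $S+\frac1{k+1}I$, and Fatou's lemma lets $k\to\infty$. -/
lemma lintegral_mul_gaussRatio_le [IsFiniteMeasure μ] (hG : G ≤ m0) {x : Ω → ι → ℝ}
    (hxm : ∀ i, Measurable fun ω => x ω i) (hx : StdSubGaussian μ G x)
    {Y : Ω → ENNReal} (hY : Measurable[G] Y) {S : Ω → Matrix ι ι ℝ} {c : Ω → ι → ℝ}
    (hS : ∀ i j, Measurable[G] fun ω => S ω i j) (hc : ∀ i, Measurable[G] fun ω => c ω i)
    (hpos : ∀ ω, (S ω - 1).PosSemidef) :
    ∫⁻ ω, Y ω * ENNReal.ofReal (gaussRatio (S ω) (c ω) (x ω)) ∂μ ≤ ∫⁻ ω, Y ω ∂μ := by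
  have hSm : ∀ (r : ℝ) i j, Measurable[G] fun ω => (S ω + r • (1 : Matrix ι ι ℝ)) i j :=
    fun r i j => (hS i j).add_const _
  have hu : ∀ k : ℕ, (0 : ℝ) < 1 / ((k : ℝ) + 1) := fun k => Nat.one_div_pos_of_nat
  have hle : ∀ k : ℕ, ∫⁻ ω, Y ω * ENNReal.ofReal
      (gaussRatio (S ω + (1 / ((k : ℝ) + 1)) • (1 : Matrix ι ι ℝ)) (c ω) (x ω)) ∂μ ≤
        ∫⁻ ω, Y ω ∂μ := by
    intro k
    have e : ∀ ω, S ω + (1 / ((k : ℝ) + 1)) • (1 : Matrix ι ι ℝ) =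
        (S ω - 1 + (1 / ((k : ℝ) + 1)) • (1 : Matrix ι ι ℝ)) + 1 := fun ω => by abel
    simp only [e]
    refine lintegral_mul_gaussRatio_le_of_posDef hG hxm hx hY (fun i j => ?_) hc fun ω => ?_
    · exact ((hS i j).sub_const _).add_const _
    · exact (Matrix.PosDef.one.smul (hu k)).posSemidef_add (hpos ω)
  have hSd : ∀ ω, (S ω).PosDef := fun ω => by
    have := (Matrix.PosDef.one (n := ι) (R := ℝ)).posSemidef_add (hpos ω)
    rwa [sub_add_cancel] at this
  have hlim : ∀ ω, Filter.liminf (fun k : ℕ => Y ω * ENNReal.ofReal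
      (gaussRatio (S ω + (1 / ((k : ℝ) + 1)) • (1 : Matrix ι ι ℝ)) (c ω) (x ω))) Filter.atTop =
        Y ω * ENNReal.ofReal (gaussRatio (S ω) (c ω) (x ω)) := by
    intro ω
    refine Filter.Tendsto.liminf_eq (ENNReal.Tendsto.const_mul (ENNReal.tendsto_ofReal
      (tendsto_gaussRatio (hSd ω) _ _ tendsto_one_div_add_atTop_nhds_zero_nat)) (Or.inl ?_))
    -- A nonzero limit is needed because $Y$ may take the value `⊤`.
    rw [Ne, ENNReal.ofReal_eq_zero, not_le]
    exact div_pos (Real.exp_pos _) (Real.sqrt_pos.2 (hSd ω).det_pos)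
  simp only [← hlim]
  refine (lintegral_liminf_le fun k => ?_).trans
    (Filter.liminf_le_of_frequently_le' (Filter.Frequently.of_forall hle))
  exact (hY.mono hG le_rfl).mul (measurable_gaussRatio
    (fun i j => (hSm _ i j).mono hG le_rfl) (fun i => (hc i).mono hG le_rfl) hxm).ennreal_ofReal

end ConditionalStep

/-! ### Ville's inequality -/

section MaximalInequality

variable {Ω : Type*} {m0 : MeasurableSpace Ω} {μ : Measure Ω}

/-- Ville's maximal inequality for a nonnegative supermartingale. -/
lemma mul_measure_exists_gt_le {ℱ : ℕ → MeasurableSpace Ω} (hmono : Monotone ℱ)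
    (hle : ∀ n, ℱ n ≤ m0) {N : ℕ → Ω → ENNReal} (hN : ∀ n, Measurable[ℱ n] (N n))
    (h0 : ∫⁻ ω, N 0 ω ∂μ ≤ 1)
    (hstep : ∀ n (A : Set Ω), MeasurableSet[ℱ n] A →
      ∫⁻ ω in A, N (n + 1) ω ∂μ ≤ ∫⁻ ω in A, N n ω ∂μ) (c : ENNReal) :
    c * μ {ω | ∃ n, c < N n ω} ≤ 1 := by
  set A : ℕ → Set Ω := fun n => {ω | ∀ k ≤ n, N k ω ≤ c} with hA
  have hAm : ∀ n, MeasurableSet[ℱ n] (A n) := by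
    intro n
    have : A n = ⋂ k, ⋂ (_ : k ≤ n), {ω | N k ω ≤ c} := by ext; simp [hA]
    rw [this]
    refine @MeasurableSet.iInter Ω ℕ (ℱ n) _ _ fun k =>
      @MeasurableSet.iInter Ω _ (ℱ n) _ _ fun hk => ?_
    exact ((hN k).mono (hmono hk) le_rfl) measurableSet_Iic
  have hAm' : ∀ n, MeasurableSet (A n) := fun n => hle n _ (hAm n)
  have hNm : ∀ n, Measurable (N n) := fun n => (hN n).mono (hle n) le_rfl
  -- This replaces optional stopping: `A n` is the event that level $c$ has not been exceeded up to
  -- time $n$. Points leaving it at time $n+1$ have $N_{n+1}>c$, which pays for the growth of the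
  -- second term.
  have key : ∀ n, ∫⁻ ω in A n, N n ω ∂μ + c * μ (A n)ᶜ ≤ 1 := by
    intro n
    induction n with
    | zero =>
      refine le_trans ?_ h0
      rw [← lintegral_add_compl (μ := μ) (fun ω => N 0 ω) (hAm' 0)]
      refine add_le_add le_rfl ?_
      rw [← setLIntegral_const]
      refine setLIntegral_mono (hNm 0) fun ω hω => ?_
      simp only [hA, Set.mem_compl_iff, Set.mem_ofPred_eq, nonpos_iff_eq_zero, forall_eq,
        not_le] at hω
      exact hω.le
    | succ n ih =>
      refine le_trans ?_ ih
      have hsub : A (n + 1) ⊆ A n := fun ω hω k hk => hω k (hk.trans n.le_succ)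
      have hd : (A (n + 1))ᶜ = (A n \ A (n + 1)) ∪ (A n)ᶜ := by
        ext ω
        have := @hsub ω
        simp only [Set.mem_compl_iff, Set.mem_union, Set.mem_sdiff]
        tauto
      calc ∫⁻ ω in A (n + 1), N (n + 1) ω ∂μ + c * μ (A (n + 1))ᶜ
          ≤ ∫⁻ ω in A (n + 1), N (n + 1) ω ∂μ + c * (μ (A n \ A (n + 1)) + μ (A n)ᶜ) := by
            gcongr
            rw [hd]
            exact measure_union_le _ _
        _ ≤ ∫⁻ ω in A (n + 1), N (n + 1) ω ∂μ + ∫⁻ ω in A n \ A (n + 1), N (n + 1) ω ∂μ +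
              c * μ (A n)ᶜ := by
            rw [mul_add, ← add_assoc]
            gcongr
            rw [← setLIntegral_const]
            refine setLIntegral_mono (hNm _) fun ω hω => ?_
            by_contra hlt
            refine hω.2 fun k hk => ?_
            rcases Nat.le_succ_iff.1 hk with h | rfl
            · exact hω.1 k h
            · exact (not_le.1 hlt).le
        _ = ∫⁻ ω in A n, N (n + 1) ω ∂μ + c * μ (A n)ᶜ := by
            congr 1
            have := lintegral_inter_add_sdiff (μ := μ) (N (n + 1)) (A n) (hAm' (n + 1))
            rwa [Set.inter_eq_right.2 hsub] at this
        _ ≤ ∫⁻ ω in A n, N n ω ∂μ + c * μ (A n)ᶜ := by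
            exact add_le_add_left (hstep n _ (hAm n)) _
  have hU : {ω | ∃ n, c < N n ω} = ⋃ n, (A n)ᶜ := by
    ext ω
    simp only [hA, Set.mem_ofPred_eq, Set.mem_iUnion, Set.mem_compl_iff, not_forall, not_le,
      exists_prop]
    exact ⟨fun ⟨n, hn⟩ => ⟨n, n, le_rfl, hn⟩, fun ⟨_, k, _, hk⟩ => ⟨k, hk⟩⟩
  have hm : Monotone fun n => (A n)ᶜ := fun i j hij =>
    Set.compl_subset_compl.2 fun ω hω k hk => hω k (hk.trans hij)
  rw [hU, hm.measure_iUnion, ENNReal.mul_iSup]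
  exact iSup_le fun n => le_add_self.trans (key n)

end MaximalInequality

/-! ### Marginal and conditional factors of a Gaussian with covariance $1+T$ -/

section SchurRecursion

lemma one_add_posDef {κ : Type*} [DecidableEq κ] {T : Matrix κ κ ℝ} 
    (hT : T.PosSemidef) : (1 + T).PosDef :=
  Matrix.PosDef.one.add_posSemidef hT

lemma toBlocks₁₁_posSemidef {κ ι : Type*} {T : Matrix (κ ⊕ ι) (κ ⊕ ι) ℝ} 
    (hT : T.PosSemidef) :
    T.toBlocks₁₁.PosSemidef :=
  hT.submatrix Sum.inl

lemma toBlocks₂₁_eq_transpose {κ ι : Type*} {T : Matrix (κ ⊕ ι) (κ ⊕ ι) ℝ} 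
    (hT : T.PosSemidef) :
    T.toBlocks₂₁ = T.toBlocks₁₂.transpose := by
  ext i j
  exact (hT.isHermitian.apply (Sum.inr i) (Sum.inl j)).symm

lemma one_add_eq_fromBlocks {κ ι : Type*} [DecidableEq κ] [DecidableEq ι]
    (T : Matrix (κ ⊕ ι) (κ ⊕ ι) ℝ) :
    1 + T = Matrix.fromBlocks (1 + T.toBlocks₁₁) T.toBlocks₁₂ T.toBlocks₂₁
      (1 + T.toBlocks₂₂) := by
  conv_lhs => rw [← Matrix.fromBlocks_toBlocks T, ← Matrix.fromBlocks_one]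
  rw [Matrix.fromBlocks_add, zero_add, zero_add]

variable {κ κ' ι : Type*} [Fintype κ] [Fintype κ'] [Fintype ι] [DecidableEq κ] [DecidableEq κ']
  [DecidableEq ι]

lemma gaussRatio_submatrix (W : Matrix κ κ ℝ) (e : κ' ≃ κ) (v : κ → ℝ) :
    gaussRatio (W.submatrix e e) 0 (v ∘ e) = gaussRatio W 0 v := by
  unfold gaussRatio
  rw [Matrix.det_submatrix_equiv_self, Matrix.inv_submatrix_equiv, sub_zero, sub_zero,
    Matrix.submatrix_mulVec_equiv, comp_equiv_dotProduct_comp_equiv, Function.comp_assoc,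
    Equiv.self_comp_symm, Function.comp_id, comp_equiv_dotProduct_comp_equiv]

/-- The conditional covariance of the second block of a Gaussian with covariance `1 + T`. -/
noncomputable def condCov (T : Matrix (κ ⊕ ι) (κ ⊕ ι) ℝ) : Matrix ι ι ℝ :=
  1 + T.toBlocks₂₂ - T.toBlocks₂₁ * (1 + T.toBlocks₁₁)⁻¹ * T.toBlocks₁₂

/-- The conditional mean of the second block of a Gaussian with covariance `1 + T`, given the
value `v` of the first block. -/
noncomputable def condMean (T : Matrix (κ ⊕ ι) (κ ⊕ ι) ℝ) (v : κ → ℝ) : ι → ℝ :=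
  T.toBlocks₂₁.mulVec ((1 + T.toBlocks₁₁)⁻¹.mulVec v)

/-- Subtracting 1 leaves the Schur complement of $\mathrm{diag}(1,0)+T$, which is positive
semidefinite. This makes the conditional law a mixture of unit-covariance Gaussians, as the
one-round bound requires. -/
lemma condCov_sub_one_posSemidef {T : Matrix (κ ⊕ ι) (κ ⊕ ι) ℝ} (hT : T.PosSemidef) :
    (condCov T - 1).PosSemidef := by
  have hA := one_add_posDef (toBlocks₁₁_posSemidef hT)
  have : Invertible (1 + T.toBlocks₁₁) := hA.isUnit.invertible
  have hd : (Matrix.fromBlocks (1 : Matrix κ κ ℝ) 0 0 (0 : Matrix ι ι ℝ)).PosSemidef := by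
    have e : Matrix.fromBlocks (1 : Matrix κ κ ℝ) 0 0 (0 : Matrix ι ι ℝ) =
        Matrix.diagonal (Sum.elim 1 0) := by
      ext i j
      rcases i with i | i <;> rcases j with j | j <;>
        simp [Matrix.diagonal_apply, Matrix.one_apply]
    rw [e]
    refine Matrix.PosSemidef.diagonal fun i => ?_
    cases i <;> simp
  have hF := hd.add hT
  have e : Matrix.fromBlocks (1 : Matrix κ κ ℝ) 0 0 (0 : Matrix ι ι ℝ) + T =
      Matrix.fromBlocks (1 + T.toBlocks₁₁) T.toBlocks₁₂ T.toBlocks₁₂.conjTranspose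
        T.toBlocks₂₂ := by
    conv_lhs => rw [← Matrix.fromBlocks_toBlocks T]
    rw [Matrix.fromBlocks_add, zero_add, zero_add, zero_add,
      Matrix.conjTranspose_eq_transpose_of_trivial, toBlocks₂₁_eq_transpose hT]
  rw [e, Matrix.PosDef.fromBlocks₁₁ _ _ hA, Matrix.conjTranspose_eq_transpose_of_trivial,
    ← toBlocks₂₁_eq_transpose hT] at hF
  have e2 : condCov T - 1 = T.toBlocks₂₂ - T.toBlocks₂₁ * (1 + T.toBlocks₁₁)⁻¹ *
      T.toBlocks₁₂ := by
    unfold condCov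
    abel
  rwa [e2]

lemma condCov_posDef {T : Matrix (κ ⊕ ι) (κ ⊕ ι) ℝ} (hT : T.PosSemidef) :
    (condCov T).PosDef := by
  have := one_add_posDef (condCov_sub_one_posSemidef hT)
  rwa [add_sub_cancel] at this

lemma det_one_add {T : Matrix (κ ⊕ ι) (κ ⊕ ι) ℝ} (hT : T.PosSemidef) :
    (1 + T).det = (1 + T.toBlocks₁₁).det * (condCov T).det := by
  have : Invertible (1 + T.toBlocks₁₁) :=
    (one_add_posDef (toBlocks₁₁_posSemidef hT)).isUnit.invertible
  rw [one_add_eq_fromBlocks, Matrix.det_fromBlocks₁₁, Matrix.invOf_eq_nonsing_inv, condCov]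

lemma dotProduct_one_add_inv_mulVec {T : Matrix (κ ⊕ ι) (κ ⊕ ι) ℝ} (hT : T.PosSemidef)
    (v : κ → ℝ) (x : ι → ℝ) :
    Sum.elim v x ⬝ᵥ (1 + T)⁻¹.mulVec (Sum.elim v x) = v ⬝ᵥ (1 + T.toBlocks₁₁)⁻¹.mulVec v +
      (x - condMean T v) ⬝ᵥ (condCov T)⁻¹.mulVec (x - condMean T v) := by
  have hA := one_add_posDef (toBlocks₁₁_posSemidef hT)
  set A := 1 + T.toBlocks₁₁ with hAdef
  have hAu : IsUnit A.det := hA.det_pos.ne'.isUnit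
  have hSu : IsUnit (condCov T).det := (condCov_posDef hT).det_pos.ne'.isUnit
  have hTu : IsUnit (1 + T).det := (one_add_posDef hT).det_pos.ne'.isUnit
  set w := (condCov T)⁻¹.mulVec (x - condMean T v) with hw
  -- Block elimination: $(u,w)$ solves $(1+T)(u,w)=(v,x)$, with $w$ from the Schur complement and
  -- $u$ by back substitution.
  set u := A⁻¹.mulVec (v - T.toBlocks₁₂.mulVec w) with hu
  have hSw : (condCov T).mulVec w = x - condMean T v := by
    rw [hw, Matrix.mulVec_mulVec, Matrix.mul_nonsing_inv _ hSu, Matrix.one_mulVec]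
  have hAu' : A.mulVec u = v - T.toBlocks₁₂.mulVec w := by
    rw [hu, Matrix.mulVec_mulVec, Matrix.mul_nonsing_inv _ hAu, Matrix.one_mulVec]
  have hcm : condMean T v = T.toBlocks₂₁.mulVec (A⁻¹.mulVec v) := rfl
  have hsolve : (1 + T).mulVec (Sum.elim u w) = Sum.elim v x := by
    rw [one_add_eq_fromBlocks, ← hAdef, Matrix.fromBlocks_mulVec]
    simp only [Sum.elim_comp_inl, Sum.elim_comp_inr]
    congr 1
    · rw [hAu', sub_add_cancel]
    · have h1 : (1 + T.toBlocks₂₂).mulVec w = (condCov T).mulVec w +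
          T.toBlocks₂₁.mulVec (A⁻¹.mulVec (T.toBlocks₁₂.mulVec w)) := by
        rw [Matrix.mulVec_mulVec w, Matrix.mulVec_mulVec w, ← Matrix.add_mulVec, condCov, ← hAdef,
          ← Matrix.mul_assoc, sub_add_cancel]
      rw [h1, hSw, hu, hcm, Matrix.mulVec_sub, Matrix.mulVec_sub]
      abel
  have hinv : (1 + T)⁻¹.mulVec (Sum.elim v x) = Sum.elim u w := by
    rw [← hsolve, Matrix.mulVec_mulVec, Matrix.nonsing_inv_mul _ hTu, Matrix.one_mulVec]
  have hsymm : v ⬝ᵥ A⁻¹.mulVec (T.toBlocks₁₂.mulVec w) = condMean T v ⬝ᵥ w := by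
    have hAt : A⁻¹.transpose = A⁻¹ := by
      have := hA.inv.isHermitian.eq
      rwa [Matrix.conjTranspose_eq_transpose_of_trivial] at this
    rw [Matrix.dotProduct_mulVec, Matrix.dotProduct_mulVec, ← Matrix.mulVec_transpose,
      ← Matrix.mulVec_transpose, hAt, ← toBlocks₂₁_eq_transpose hT, hcm]
  rw [hinv, sumElim_dotProduct_sumElim, hu, Matrix.mulVec_sub, dotProduct_sub, hsymm,
    sub_dotProduct]
  ring

/-- The joint density is the marginal density times the conditional one; the standard Gaussian
factorizes as well. -/
lemma gaussRatio_one_add {T : Matrix (κ ⊕ ι) (κ ⊕ ι) ℝ} (hT : T.PosSemidef)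
    (v : κ → ℝ) (x : ι → ℝ) :
    gaussRatio (1 + T) 0 (Sum.elim v x) =
      gaussRatio (1 + T.toBlocks₁₁) 0 v * gaussRatio (condCov T) (condMean T v) x := by
  unfold gaussRatio
  rw [sub_zero, sub_zero, dotProduct_one_add_inv_mulVec hT, det_one_add hT,
    Real.sqrt_mul (one_add_posDef (toBlocks₁₁_posSemidef hT)).det_pos.le,
    sumElim_dotProduct_sumElim, div_mul_div_comm, ← Real.exp_add]
  congr 2
  ring

end SchurRecursion

/-! ### Measurability of the conditional mean and covariance -/

section ConditionalMeasurability

variable {Ω κ : Type*} [Fintype κ] {G : MeasurableSpace Ω}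

lemma measurable_matrix_mul_entry {α β : Type*} {S : Ω → Matrix α κ ℝ} {T : Ω → Matrix κ β ℝ}
    (hS : ∀ i j, Measurable[G] fun ω => S ω i j) (hT : ∀ i j, Measurable[G] fun ω => T ω i j)
    (i : α) (j : β) : Measurable[G] fun ω => (S ω * T ω) i j :=
  Finset.measurable_sum _ fun k _ => (hS i k).mul (hT k j)

variable {ι : Type*} [DecidableEq κ]

lemma measurable_condCov [DecidableEq ι] {T : Ω → Matrix (κ ⊕ ι) (κ ⊕ ι) ℝ}
    (hT : ∀ i j, Measurable[G] fun ω => T ω i j) (i j : ι) :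
    Measurable[G] fun ω => condCov (T ω) i j :=
  ((hT _ _).const_add _).sub (measurable_matrix_mul_entry (measurable_matrix_mul_entry
    (fun _ _ => hT _ _) (measurable_inv_entry fun _ _ => (hT _ _).const_add _))
    (fun _ _ => hT _ _) i j)

lemma measurable_condMean {T : Ω → Matrix (κ ⊕ ι) (κ ⊕ ι) ℝ} {v : Ω → κ → ℝ}
    (hT : ∀ i j, Measurable[G] fun ω => T ω i j) (hv : ∀ i, Measurable[G] fun ω => v ω i)
    (i : ι) : Measurable[G] fun ω => condMean (T ω) (v ω) i :=
  measurable_mulVec_entry (fun _ _ => hT _ _) (measurable_mulVec_entry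
    (measurable_inv_entry fun _ _ => (hT _ _).const_add _) hv) i

end ConditionalMeasurability

/-! ### Kernel expressions for the $V$-norms and the deterministic error bounds -/

section KernelIdentities

variable {H A : Type*} [NormedAddCommGroup H] [InnerProductSpace ℝ H] [CompleteSpace H] {m n : ℕ}

/-- The feature in `H` of the `p.2`-th feedback coordinate in round `p.1`. -/
noncomputable def feedbackFeature (M : A → H →L[ℝ] EuclideanSpace ℝ (Fin m)) (h : Fin n → A)
    (p : Fin n × Fin m) : H :=
  ContinuousLinearMap.adjoint (M (h p.1)) (EuclideanSpace.single p.2 1)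

lemma adjoint_single_inner (L : H →L[ℝ] EuclideanSpace ℝ (Fin m)) (j : Fin m) (f : H) :
    ⟪ContinuousLinearMap.adjoint L (EuclideanSpace.single j 1), f⟫ = L f j := by
  rw [ContinuousLinearMap.adjoint_inner_left, EuclideanSpace.inner_single_left]
  simp

lemma kernelMatrix_apply (M : A → H →L[ℝ] EuclideanSpace ℝ (Fin m)) (h : Fin n → A)
    (p q : Fin n × Fin m) :
    kernelMatrix M h p q = ⟪feedbackFeature M h p, feedbackFeature M h q⟫ := by
  rw [feedbackFeature, adjoint_single_inner]
  rfl

lemma kernelMatrix_posSemidef (M : A → H →L[ℝ] EuclideanSpace ℝ (Fin m)) (h : Fin n → A) :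
    (kernelMatrix M h).PosSemidef := by
  have : kernelMatrix M h = Matrix.gram ℝ (feedbackFeature M h) := by
    ext p q
    exact kernelMatrix_apply M h p q
  rw [this]
  exact Matrix.posSemidef_gram ℝ _

lemma evalWeights_apply (φ : A → H) (M : A → H →L[ℝ] EuclideanSpace ℝ (Fin m)) (h : Fin n → A)
    (a : A) (p : Fin n × Fin m) :
    evalWeights φ M h a p = ⟪feedbackFeature M h p, φ a⟫ :=
  real_inner_comm _ _

lemma sum_inner_feedback (M : A → H →L[ℝ] EuclideanSpace ℝ (Fin m)) (h : Fin n → A) (g : H)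
    (x : Fin n → EuclideanSpace ℝ (Fin m)) :
    ∑ s, ⟪M (h s) g, x s⟫ = ∑ p, ⟪feedbackFeature M h p, g⟫ * x p.1 p.2 := by
  rw [Fintype.sum_prod_type]
  refine Finset.sum_congr rfl fun s _ => ?_
  simp only [feedbackFeature, adjoint_single_inner, PiLp.inner_apply]
  exact Finset.sum_congr rfl fun j _ => mul_comm _ _

lemma inner_covOp_eq_sum (M : A → H →L[ℝ] EuclideanSpace ℝ (Fin m)) (lam : ℝ) (h : Fin n → A)
    (g f : H) :
    ⟪g, covOp M lam h f⟫ =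
      (∑ p, ⟪feedbackFeature M h p, g⟫ * ⟪feedbackFeature M h p, f⟫) + lam * ⟪g, f⟫ := by
  rw [inner_covOp, sum_inner_feedback M h g fun s => M (h s) f]
  simp only [feedbackFeature, adjoint_single_inner]

lemma inner_covOp_self_nonneg (M : A → H →L[ℝ] EuclideanSpace ℝ (Fin m)) {lam : ℝ}
    (hlam : 0 < lam) (h : Fin n → A) (g : H) : 0 ≤ ⟪g, covOp M lam h g⟫ := by
  rw [inner_covOp]
  exact add_nonneg (Finset.sum_nonneg fun s _ => real_inner_self_nonneg)
    (mul_nonneg hlam.le real_inner_self_nonneg)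

lemma mul_norm_sq_le_inner_covOp_self (M : A → H →L[ℝ] EuclideanSpace ℝ (Fin m)) (lam : ℝ)
    (h : Fin n → A) (g : H) : lam * ‖g‖ ^ 2 ≤ ⟪g, covOp M lam h g⟫ := by
  rw [inner_covOp, real_inner_self_eq_norm_sq]
  exact le_add_of_nonneg_left (Finset.sum_nonneg fun s _ => real_inner_self_nonneg)

/-- Cauchy–Schwarz for the form of $V$. Dual norms are handled by pairing with explicit solutions of
$Vg=w$, so $V^{-1}$ is never formed. -/
lemma abs_inner_covOp_le (M : A → H →L[ℝ] EuclideanSpace ℝ (Fin m)) {lam : ℝ}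
    (hlam : 0 < lam) (h : Fin n → A) (g f : H) :
    |⟪g, covOp M lam h f⟫| ≤
      Real.sqrt ⟪g, covOp M lam h g⟫ * Real.sqrt ⟪f, covOp M lam h f⟫ := by
  have hcomm : ⟪f, covOp M lam h g⟫ = ⟪g, covOp M lam h f⟫ := by
    rw [inner_covOp_eq_sum, inner_covOp_eq_sum, real_inner_comm f g]
    simp only [mul_comm]
  have h1 := LinearMap.BilinForm.apply_mul_apply_le_of_forall_zero_le
    ((innerₗ H).compl₂ (covOp M lam h : H →ₗ[ℝ] H)) (inner_covOp_self_nonneg M hlam h) g f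
  simp only [LinearMap.compl₂_apply, innerₗ_apply_apply, ContinuousLinearMap.coe_coe, hcomm] at h1
  rw [← Real.sqrt_mul (inner_covOp_self_nonneg M hlam h g), ← Real.sqrt_sq_eq_abs, sq]
  exact Real.sqrt_le_sqrt h1

lemma kernelMatrix_mulVec (M : A → H →L[ℝ] EuclideanSpace ℝ (Fin m)) (h : Fin n → A)
    (α : Fin n × Fin m → ℝ) (p : Fin n × Fin m) :
    (kernelMatrix M h).mulVec α p =
      ⟪feedbackFeature M h p, ∑ q, α q • feedbackFeature M h q⟫ := by
  simp only [Matrix.mulVec, dotProduct, kernelMatrix_apply, inner_sum, inner_smul_right]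
  exact Finset.sum_congr rfl fun q _ => mul_comm _ _

lemma kernelMatrix_add_smul_posDef (M : A → H →L[ℝ] EuclideanSpace ℝ (Fin m)) {lam : ℝ}
    (hlam : 0 < lam) (h : Fin n → A) :
    (kernelMatrix M h + lam • (1 : Matrix (Fin n × Fin m) (Fin n × Fin m) ℝ)).PosDef :=
  (Matrix.PosDef.one.smul hlam).posSemidef_add (kernelMatrix_posSemidef M h)

/-- The regularized kernel system has a solution, given by the inverse matrix. -/
lemma mulVec_inv_kernelMatrix (M : A → H →L[ℝ] EuclideanSpace ℝ (Fin m)) {lam : ℝ}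
    (hlam : 0 < lam) (h : Fin n → A) (v : Fin n × Fin m → ℝ) (p : Fin n × Fin m) :
    (kernelMatrix M h).mulVec ((kernelMatrix M h +
        lam • (1 : Matrix (Fin n × Fin m) (Fin n × Fin m) ℝ))⁻¹.mulVec v) p +
      lam * (kernelMatrix M h +
        lam • (1 : Matrix (Fin n × Fin m) (Fin n × Fin m) ℝ))⁻¹.mulVec v p = v p := by
  set D := kernelMatrix M h + lam • (1 : Matrix (Fin n × Fin m) (Fin n × Fin m) ℝ) with hD
  have h1 : D.mulVec (D⁻¹.mulVec v) = v := by
    rw [Matrix.mulVec_mulVec, Matrix.mul_nonsing_inv _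
      (kernelMatrix_add_smul_posDef M hlam h).det_pos.ne'.isUnit, Matrix.one_mulVec]
  conv_rhs => rw [← h1, hD]
  rw [Matrix.add_mulVec, Matrix.smul_mulVec, Matrix.one_mulVec]
  rfl

/-- The kernel expression for the squared dual norm of the noise term. -/
noncomputable def noiseForm (M : A → H →L[ℝ] EuclideanSpace ℝ (Fin m)) (lam : ℝ) (h : Fin n → A)
    (x : Fin n × Fin m → ℝ) : ℝ :=
  x ⬝ᵥ x - x ⬝ᵥ (1 + lam⁻¹ • kernelMatrix M h)⁻¹.mulVec x

lemma noiseForm_eq (M : A → H →L[ℝ] EuclideanSpace ℝ (Fin m)) {lam : ℝ} (hlam : 0 < lam)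
    (h : Fin n → A) (x : Fin n × Fin m → ℝ) :
    noiseForm M lam h x = x ⬝ᵥ x - lam * (x ⬝ᵥ (kernelMatrix M h +
      lam • (1 : Matrix (Fin n × Fin m) (Fin n × Fin m) ℝ))⁻¹.mulVec x) := by
  have e : (1 + lam⁻¹ • kernelMatrix M h)⁻¹ = lam • (kernelMatrix M h +
      lam • (1 : Matrix (Fin n × Fin m) (Fin n × Fin m) ℝ))⁻¹ := by
    apply Matrix.inv_eq_right_inv
    have : 1 + lam⁻¹ • kernelMatrix M h = lam⁻¹ • (kernelMatrix M h +
        lam • (1 : Matrix (Fin n × Fin m) (Fin n × Fin m) ℝ)) := by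
      rw [smul_add, smul_smul, inv_mul_cancel₀ hlam.ne', one_smul, add_comm]
    rw [this, Matrix.smul_mul, Matrix.mul_smul, smul_smul, inv_mul_cancel₀ hlam.ne', one_smul,
      Matrix.mul_nonsing_inv _ (kernelMatrix_add_smul_posDef M hlam h).det_pos.ne'.isUnit]
  rw [noiseForm, e, Matrix.smul_mulVec, dotProduct_smul, smul_eq_mul]

lemma abs_sum_feedback_mul_le (M : A → H →L[ℝ] EuclideanSpace ℝ (Fin m)) {lam : ℝ}
    (hlam : 0 < lam) (h : Fin n → A) (x : Fin n × Fin m → ℝ) (d : H) :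
    |∑ p, ⟪feedbackFeature M h p, d⟫ * x p| ≤
      Real.sqrt ⟪d, covOp M lam h d⟫ * Real.sqrt (noiseForm M lam h x) := by
  set α := (kernelMatrix M h +
    lam • (1 : Matrix (Fin n × Fin m) (Fin n × Fin m) ℝ))⁻¹.mulVec x with hα
  -- With $\alpha=(K+\lambda)^{-1}x$, this $g$ solves $Vg=\sum_p x_p\,\texttt{feedbackFeature}_p$,
  -- and $\langle g,Vg\rangle$ is the noise form.
  set g := ∑ q, α q • feedbackFeature M h q with hg
  have hsys : ∀ p, ⟪feedbackFeature M h p, g⟫ + lam * α p = x p := fun p => by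
    rw [hg, ← kernelMatrix_mulVec, hα, mulVec_inv_kernelMatrix M hlam h x p]
  have hV : ∀ f, ⟪f, covOp M lam h g⟫ = ∑ p, ⟪feedbackFeature M h p, f⟫ * x p := fun f => by
    have e : lam * ⟪f, g⟫ = ∑ p, ⟪feedbackFeature M h p, f⟫ * (lam * α p) := by
      rw [hg, inner_sum, Finset.mul_sum]
      refine Finset.sum_congr rfl fun p _ => ?_
      rw [inner_smul_right, real_inner_comm]
      ring
    rw [inner_covOp_eq_sum, e, ← Finset.sum_add_distrib]
    refine Finset.sum_congr rfl fun p _ => ?_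
    rw [← mul_add, hsys]
  have hgg : ⟪g, covOp M lam h g⟫ = noiseForm M lam h x := by
    rw [hV, noiseForm_eq M hlam, ← hα]
    simp only [dotProduct, Finset.mul_sum, ← Finset.sum_sub_distrib]
    refine Finset.sum_congr rfl fun p _ => ?_
    linear_combination x p * hsys p
  rw [← hV, ← hgg]
  exact abs_inner_covOp_le M hlam h d g

lemma abs_inner_feature_le (φ : A → H) (M : A → H →L[ℝ] EuclideanSpace ℝ (Fin m)) {lam : ℝ}
    (hlam : 0 < lam) (h : Fin n → A) (b c : A) (d : H) :
    |⟪φ b - φ c, d⟫| ≤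
      Real.sqrt ⟪d, covOp M lam h d⟫ * Real.sqrt (featureUncertainty φ M lam h b c) := by
  set k := evalWeights φ M h b - evalWeights φ M h c with hk
  set α := (kernelMatrix M h +
    lam • (1 : Matrix (Fin n × Fin m) (Fin n × Fin m) ℝ))⁻¹.mulVec k with hα
  -- This is $V^{-1}(\phi_b-\phi_c)$ in the form given by the Woodbury identity.
  set v := lam⁻¹ • (φ b - φ c - ∑ q, α q • feedbackFeature M h q) with hv
  have hkp : ∀ p, k p = ⟪feedbackFeature M h p, φ b - φ c⟫ := fun p => by
    rw [hk, Pi.sub_apply, evalWeights_apply, evalWeights_apply, inner_sub_right]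
  have hvp : ∀ p, ⟪feedbackFeature M h p, v⟫ = α p := fun p => by
    have h1 := mulVec_inv_kernelMatrix M hlam h k p
    rw [← hα, kernelMatrix_mulVec] at h1
    rw [hv, inner_smul_right, inner_sub_right, ← hkp, ← h1]
    field_simp
    ring
  have hV : ∀ f, ⟪f, covOp M lam h v⟫ = ⟪f, φ b - φ c⟫ := fun f => by
    rw [inner_covOp_eq_sum]
    simp only [hvp]
    rw [hv, inner_smul_right, ← mul_assoc, mul_inv_cancel₀ hlam.ne', one_mul, inner_sub_right _ _
      (∑ q, _), inner_sum]
    have e : ∑ q, ⟪f, α q • feedbackFeature M h q⟫ = ∑ p, ⟪feedbackFeature M h p, f⟫ * α p :=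
      Finset.sum_congr rfl fun p _ => by rw [inner_smul_right, real_inner_comm, mul_comm]
    rw [e]
    ring
  have hvv : ⟪v, covOp M lam h v⟫ = featureUncertainty φ M lam h b c := by
    have e : ⟪φ b - φ c, φ b - φ c⟫ = kernelMetric φ b c := by
      rw [kernelMetric, kPhi, kPhi, kPhi, inner_sub_left, inner_sub_right, inner_sub_right,
        real_inner_comm (φ b) (φ c)]
      ring
    have e2 : ⟪∑ q, α q • feedbackFeature M h q, φ b - φ c⟫ = k ⬝ᵥ α := by
      rw [sum_inner]
      refine Finset.sum_congr rfl fun p _ => ?_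
      rw [real_inner_smul_left, ← hkp, mul_comm]
    rw [hV, hv, real_inner_smul_left, inner_sub_left _ (∑ q, _), e, e2, featureUncertainty,
      one_div]
  rw [← hvv, real_inner_comm, ← hV]
  exact abs_inner_covOp_le M hlam h d v

/-- The normal equation of the least-squares estimate. -/
lemma lsEstimate_normalEq (M : A → H →L[ℝ] EuclideanSpace ℝ (Fin m)) {lam : ℝ}
    (hlam : 0 < lam) (h : Fin n → A) (y : Fin n → EuclideanSpace ℝ (Fin m)) (g : H) :
    (∑ s, ⟪M (h s) g, M (h s) (lsEstimate M lam h y) - y s⟫) +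
      lam * ⟪g, lsEstimate M lam h y⟫ = 0 := by
  set f := lsEstimate M lam h y with hf
  have hmin := lsEstimate_isMinOn M hlam h y
  rw [← hf] at hmin
  set L := (∑ s, ⟪M (h s) g, M (h s) f - y s⟫) + lam * ⟪g, f⟫ with hL
  set Q := (∑ s, ‖M (h s) g‖ ^ 2) + lam * ‖g‖ ^ 2 with hQ
  -- Along a line the objective is quadratic in $t$ with minimum at $t=0$, so the nonpositive
  -- discriminant forces its linear coefficient $L$ to vanish.
  have hexp : ∀ t : ℝ, lsObjective M lam h y (f + t • g) =
      lsObjective M lam h y f + 2 * t * L + t ^ 2 * Q := fun t => by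
    have h1 : ∀ s, ‖M (h s) (f + t • g) - y s‖ ^ 2 = ‖M (h s) f - y s‖ ^ 2 +
        2 * t * ⟪M (h s) g, M (h s) f - y s⟫ + t ^ 2 * ‖M (h s) g‖ ^ 2 := fun s => by
      have e : M (h s) (f + t • g) - y s = (M (h s) f - y s) + t • M (h s) g := by
        rw [map_add, map_smul]
        abel
      rw [e, norm_add_sq_real, inner_smul_right, real_inner_comm, norm_smul, mul_pow,
        Real.norm_eq_abs, sq_abs]
      ring
    have h2 : ‖f + t • g‖ ^ 2 = ‖f‖ ^ 2 + 2 * t * ⟪g, f⟫ + t ^ 2 * ‖g‖ ^ 2 := by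
      rw [norm_add_sq_real, inner_smul_right, real_inner_comm, norm_smul, mul_pow,
        Real.norm_eq_abs, sq_abs]
      ring
    simp only [lsObjective, h1, h2, Finset.sum_add_distrib, ← Finset.mul_sum, hL, hQ]
    ring
  have hnn : ∀ t : ℝ, 0 ≤ Q * (t * t) + 2 * L * t + 0 := fun t => by
    have h1 : lsObjective M lam h y f ≤ lsObjective M lam h y (f + t • g) :=
      hmin (Set.mem_univ _)
    rw [hexp] at h1
    linarith
  have h2 := discrim_le_zero hnn
  rw [discrim] at h2
  have h3 : L ^ 2 ≤ 0 := by linarith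
  exact pow_eq_zero_iff two_ne_zero |>.1 (le_antisymm h3 (sq_nonneg _))

/-- Testing the normal equation with $d$ itself gives $\|d\|_V^2=\lambda\langle
d,f\rangle-\sum_s\langle M_{a_s}d,x_s\rangle$. Each term is at most $\|d\|_V$ times one summand of
the bound, using $\sqrt\lambda\|d\|\le\|d\|_V$ for the first; then divide by $\|d\|_V$. -/
lemma sqrt_covOp_error_le (M : A → H →L[ℝ] EuclideanSpace ℝ (Fin m)) {lam B : ℝ}
    (hlam : 0 < lam) (h : Fin n → A) (x : Fin n → EuclideanSpace ℝ (Fin m)) {f : H}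
    (hB : ‖f‖ ≤ B) {d : H} (hd : d = f - lsEstimate M lam h fun s => M (h s) f + x s) :
    Real.sqrt ⟪d, covOp M lam h d⟫ ≤
      Real.sqrt (noiseForm M lam h fun p => x p.1 p.2) + Real.sqrt lam * B := by
  have hn := lsEstimate_normalEq M hlam h (fun s => M (h s) f + x s) d
  set F := lsEstimate M lam h fun s => M (h s) f + x s with hF
  have hFd : F = f - d := by rw [hd]; abel
  have e : ∀ s, M (h s) F - (M (h s) f + x s) = -(M (h s) d + x s) := fun s => by
    rw [hFd, map_sub]
    abel
  simp only [e, inner_neg_right, Finset.sum_neg_distrib, inner_add_right,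
    Finset.sum_add_distrib] at hn
  rw [hFd, inner_sub_right] at hn
  have hVd := inner_covOp M lam h d d
  have hsum := sum_inner_feedback M h d x
  have hnoise := abs_sum_feedback_mul_le M hlam h (fun p => x p.1 p.2) d
  set r := Real.sqrt ⟪d, covOp M lam h d⟫ with hr
  have hr0 : 0 ≤ r := Real.sqrt_nonneg _
  have hr2 : r * r = ⟪d, covOp M lam h d⟫ :=
    Real.mul_self_sqrt (inner_covOp_self_nonneg M hlam h d)
  have hdr : Real.sqrt lam * ‖d‖ ≤ r := by
    rw [hr]
    apply Real.le_sqrt_of_sq_le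
    rw [mul_pow, Real.sq_sqrt hlam.le]
    exact mul_norm_sq_le_inner_covOp_self M lam h d
  have hdf : lam * ⟪d, f⟫ ≤ r * (Real.sqrt lam * B) := by
    have h1 : ⟪d, f⟫ ≤ ‖d‖ * B :=
      (real_inner_le_norm d f).trans (mul_le_mul_of_nonneg_left hB (norm_nonneg _))
    have h2 : lam = Real.sqrt lam * Real.sqrt lam := (Real.mul_self_sqrt hlam.le).symm
    have hB0 : 0 ≤ Real.sqrt lam * B := mul_nonneg (Real.sqrt_nonneg _) ((norm_nonneg _).trans hB)
    calc lam * ⟪d, f⟫ ≤ lam * (‖d‖ * B) := mul_le_mul_of_nonneg_left h1 hlam.le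
      _ = (Real.sqrt lam * ‖d‖) * (Real.sqrt lam * B) := by
        conv_lhs => rw [h2]
        ring
      _ ≤ r * (Real.sqrt lam * B) := mul_le_mul_of_nonneg_right hdr hB0
  have hmain : r * r ≤ r * (Real.sqrt (noiseForm M lam h fun p => x p.1 p.2) +
      Real.sqrt lam * B) := by
    have := neg_abs_le (∑ p, ⟪feedbackFeature M h p, d⟫ * x p.1 p.2)
    rw [mul_add]
    linarith
  rcases hr0.eq_or_lt with h0 | h0
  · rw [← h0]
    have hB0 : 0 ≤ B := (norm_nonneg _).trans hB
    positivity
  · exact le_of_mul_le_mul_left hmain h0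

lemma mem_confSet_of_noiseForm_le (M : A → H →L[ℝ] EuclideanSpace ℝ (Fin m)) {lam ρ B δ : ℝ}
    (hlam : 0 < lam) (hρ : 0 ≤ ρ) (h : Fin n → A) (x : Fin n → EuclideanSpace ℝ (Fin m)) {f : H}
    (hB : ‖f‖ ≤ B)
    (hx : noiseForm M lam h (fun p => x p.1 p.2) ≤ ρ ^ 2 * (2 * Real.log (1 / δ) +
      Real.log (Matrix.det (1 + lam⁻¹ • kernelMatrix M h)))) :
    f ∈ confSet M lam ρ B δ h fun s => M (h s) f + x s := by
  have h1 := sqrt_covOp_error_le M hlam h x hB rfl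
  have h2 := Real.sqrt_le_sqrt hx
  rw [Real.sqrt_mul (sq_nonneg _), Real.sqrt_sq hρ] at h2
  have h3 := h1.trans (add_le_add_left h2 _)
  exact (Real.sqrt_le_left ((Real.sqrt_nonneg _).trans h3)).1 h3

lemma abs_inner_error_le (φ : A → H) (M : A → H →L[ℝ] EuclideanSpace ℝ (Fin m))
    {lam ρ B δ : ℝ} (hlam : 0 < lam) (h : Fin n → A) (y : Fin n → EuclideanSpace ℝ (Fin m))
    {f : H} (hf : f ∈ confSet M lam ρ B δ h y) (b c : A) :
    |⟪φ b - φ c, lsEstimate M lam h y - f⟫| ≤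
      Real.sqrt (beta M lam ρ B δ h * featureUncertainty φ M lam h b c) := by
  have h1 := abs_inner_feature_le φ M hlam h b c (f - lsEstimate M lam h y)
  rw [← neg_sub f, inner_neg_right, abs_neg,
    Real.sqrt_mul (show 0 ≤ beta M lam ρ B δ h from sq_nonneg _)]
  exact h1.trans (mul_le_mul_of_nonneg_right (Real.sqrt_le_sqrt hf) (Real.sqrt_nonneg _))

end KernelIdentities

/-! ### Measurability of the feedback from measurability of the kernel -/

section FeedbackMeasurability

variable {H A : Type*} [NormedAddCommGroup H] [InnerProductSpace ℝ H] [CompleteSpace H]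
  [MeasurableSpace A] {m : ℕ}

/-- If the kernel is measurable, then so is the feedback of every fixed element of `H`. -/
lemma measurable_feedback {M : A → H →L[ℝ] EuclideanSpace ℝ (Fin m)}
    (hM : ∀ i j, Measurable fun p : A × A => kM M p.1 p.2 i j) (f : H) (i : Fin m) :
    Measurable fun b => M b f i := by
  let U : Submodule ℝ H :=
    { carrier := {f | ∀ i, Measurable fun b => M b f i}
      add_mem' := fun {f g} hf hg i => by
        simp only [map_add, PiLp.add_apply]
        exact (hf i).add (hg i)
      zero_mem' := fun i => by
        simpa only [map_zero, PiLp.zero_apply] using measurable_const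
      smul_mem' := fun r f hf i => by
        simp only [map_smul, PiLp.smul_apply]
        exact (hf i).const_smul r }
  have hclosed : IsClosed (U : Set H) := by
    refine IsSeqClosed.isClosed fun u f hu hf i => ?_
    refine measurable_of_tendsto_metrizable (fun k => hu k i) (tendsto_pi_nhds.2 fun b => ?_)
    have : Continuous fun g : H => M b g i :=
      (EuclideanSpace.proj (𝕜 := ℝ) i).continuous.comp (M b).continuous
    exact (this.tendsto f).comp hf
  -- The closed subspace `U` contains every $M_k^*e_j$, since the coordinates of $M_bM_k^*e_j$ are
  -- kernel entries. If $g\perp U$ then $M_bg=0$ for all $b$, so $g\in U$ and $g=0$. No separability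
  -- of $H$ enters.
  have horth : Uᗮ = ⊥ := by
    rw [eq_bot_iff]
    intro g hg
    have hgU : g ∈ U := fun i => by
      have : (fun b => M b g i) = fun _ => 0 := by
        ext b
        rw [← adjoint_single_inner]
        refine hg _ fun k => ?_
        exact (hM k i).comp (measurable_id.prodMk measurable_const)
      rw [this]
      exact measurable_const
    exact inner_self_eq_zero.1 (hg g hgU)
  have htop : U = ⊤ := by
    rw [← Submodule.topologicalClosure_eq_top_iff, hclosed.submodule_topologicalClosure_eq] at horth
    exact horth
  exact (htop ▸ Submodule.mem_top : f ∈ U) i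

end FeedbackMeasurability

/-! ### The filtration of actions and observations -/

section History

variable {Ω A : Type*} [MeasurableSpace A] {m : ℕ} {a : ℕ → Ω → A}
  {y : ℕ → Ω → EuclideanSpace ℝ (Fin m)}

lemma history_mono : Monotone (history a y) := fun _ _ hkn =>
  iSup_le fun s => le_iSup_of_le (Fin.castLE hkn s) le_rfl

lemma history_le_historyWithAction (n : ℕ) : history a y n ≤ historyWithAction a y n :=
  le_sup_left

lemma measurable_action_history {s n : ℕ} (hs : s < n) : Measurable[history a y n] (a s) :=
  measurable_iff_comap_le.2
    (le_iSup_of_le (f := fun s : Fin n => MeasurableSpace.comap (a s) inferInstance ⊔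
      MeasurableSpace.comap (y s) inferInstance) ⟨s, hs⟩ le_sup_left)

lemma measurable_observation_history {s n : ℕ} (hs : s < n) : Measurable[history a y n] (y s) :=
  measurable_iff_comap_le.2
    (le_iSup_of_le (f := fun s : Fin n => MeasurableSpace.comap (a s) inferInstance ⊔
      MeasurableSpace.comap (y s) inferInstance) ⟨s, hs⟩ le_sup_right)

lemma measurable_action_historyWithAction {s n : ℕ} (hs : s ≤ n) :
    Measurable[historyWithAction a y n] (a s) := by
  rcases hs.lt_or_eq with h | rfl
  · exact (measurable_action_history h).mono (history_le_historyWithAction n) le_rfl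
  · exact measurable_iff_comap_le.2 le_sup_right

lemma historyWithAction_le {m0 : MeasurableSpace Ω} (ha : ∀ t, Measurable (a t))
    (hy : ∀ t, Measurable (y t)) (n : ℕ) : historyWithAction a y n ≤ m0 :=
  sup_le (iSup_le fun s => sup_le (ha s).comap_le (hy s).comap_le) (ha n).comap_le

end History

/-! ### Rescaling the noise, and the degenerate case $\rho=0$ -/

section SubGaussian

variable {Ω : Type*} {m : ℕ} {G m0 : MeasurableSpace Ω} {μ : Measure Ω}

lemma stdSubGaussian_of_condSubGaussian {ρ : ℝ} (hρ : ρ ≠ 0)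
    {ε : Ω → EuclideanSpace ℝ (Fin m)} (h : CondSubGaussian μ G ρ ε) :
    StdSubGaussian μ G fun ω i => ρ⁻¹ * ε ω i := by
  intro u
  have e1 : ∀ ω, ⟪WithLp.toLp 2 (ρ⁻¹ • u), ε ω⟫ = u ⬝ᵥ fun i => ρ⁻¹ * ε ω i := fun ω => by
    rw [PiLp.inner_apply, dotProduct]
    refine Finset.sum_congr rfl fun i _ => ?_
    simp only [Pi.smul_apply, smul_eq_mul, RCLike.inner_apply, conj_trivial]
    ring
  have e2 : ‖WithLp.toLp 2 (ρ⁻¹ • u)‖ ^ 2 * ρ ^ 2 / 2 = u ⬝ᵥ u / 2 := by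
    rw [EuclideanSpace.real_norm_sq_eq, dotProduct, Finset.sum_mul]
    congr 1
    refine Finset.sum_congr rfl fun i _ => ?_
    simp only [Pi.smul_apply, smul_eq_mul]
    field_simp
  have := h (WithLp.toLp 2 (ρ⁻¹ • u))
  simp only [e1, e2] at this
  exact this

/-- For each coordinate $s$ of the noise, $e^s+e^{-s}-2$ is nonnegative, vanishes only at $s=0$, and
has nonpositive integral. -/
lemma ae_eq_zero_of_condSubGaussian_zero [IsProbabilityMeasure μ] (hG : G ≤ m0)
    {ε : Ω → EuclideanSpace ℝ (Fin m)} (h : CondSubGaussian μ G 0 ε) : ∀ᵐ ω ∂μ, ε ω = 0 := by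
  have hint : ∀ u : EuclideanSpace ℝ (Fin m), ∫ ω, Real.exp ⟪u, ε ω⟫ ∂μ ≤ 1 := fun u => by
    rw [← integral_condExp hG]
    have h1 : ∫ ω, (μ[fun ω' => Real.exp ⟪u, ε ω'⟫ | G]) ω ∂μ ≤ ∫ _, (1 : ℝ) ∂μ := by
      refine integral_mono_ae integrable_condExp (integrable_const 1) ?_
      filter_upwards [(h u).2] with ω hω
      have h2 : (‖u‖ ^ 2 * 0 ^ 2 / 2 : ℝ) = 0 := by ring
      rwa [h2, Real.exp_zero] at hω
    simpa using h1
  have hcoord : ∀ i, ∀ᵐ ω ∂μ, ε ω i = 0 := fun i => by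
    set u := EuclideanSpace.single i (1 : ℝ) with hu
    have hexp : ∀ ω, ⟪u, ε ω⟫ = ε ω i := fun ω => by
      rw [hu, EuclideanSpace.inner_single_left]
      simp
    have hi := ((h u).1.add (h (-u)).1).sub (integrable_const (2 : ℝ))
    have hi2 : ∫ ω, (Real.exp ⟪u, ε ω⟫ + Real.exp ⟪-u, ε ω⟫ - 2) ∂μ ≤ 0 := by
      have h1 : ∫ ω, (Real.exp ⟪u, ε ω⟫ + Real.exp ⟪-u, ε ω⟫ - 2) ∂μ =
          ∫ ω, Real.exp ⟪u, ε ω⟫ ∂μ + ∫ ω, Real.exp ⟪-u, ε ω⟫ ∂μ - 2 := by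
        have h2 := integral_sub ((h u).1.add (h (-u)).1) (integrable_const (μ := μ) (2 : ℝ))
        have h3 := integral_add (h u).1 (h (-u)).1
        simp only [Pi.add_apply, integral_const, probReal_univ, one_smul] at h2 h3
        rw [h2, h3]
      rw [h1]
      linarith [hint u, hint (-u)]
    have hnn : ∀ ω, 0 ≤ Real.exp ⟪u, ε ω⟫ + Real.exp ⟪-u, ε ω⟫ - 2 := fun ω => by
      rw [inner_neg_left]
      linarith [Real.add_one_le_exp ⟪u, ε ω⟫, Real.add_one_le_exp (-⟪u, ε ω⟫)]
    have hz := (integral_eq_zero_iff_of_nonneg hnn hi).1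
      (le_antisymm hi2 (integral_nonneg hnn))
    filter_upwards [hz] with ω hω
    by_contra hne
    rw [← hexp] at hne
    have h1 := Real.add_one_lt_exp hne
    have h2 := Real.add_one_le_exp (-⟪u, ε ω⟫)
    simp only [Pi.zero_apply, inner_neg_left] at hω
    linarith
  filter_upwards [ae_all_iff.2 hcoord] with ω hω
  ext i
  exact hω i

end SubGaussian

/-! ### The noise likelihood ratio as a supermartingale -/

section NoiseProcess

/-- Splitting off the last round. -/
def roundEquiv (n m : ℕ) : (Fin n × Fin m) ⊕ Fin m ≃ Fin (n + 1) × Fin m :=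
  ((Equiv.sumCongr (Equiv.refl _) (Equiv.uniqueProd (Fin m) (Fin 1)).symm).trans
    (Equiv.sumProdDistrib _ _ _).symm).trans (Equiv.prodCongr finSumFinEquiv (Equiv.refl _))

variable {H A Ω : Type*} [NormedAddCommGroup H] [InnerProductSpace ℝ H] [CompleteSpace H] {m : ℕ}

/-- The scaled kernel matrix of the first `n + 1` rounds, with the last round as second block. -/
noncomputable def splitKernel (M : A → H →L[ℝ] EuclideanSpace ℝ (Fin m)) (lam : ℝ) (h : ℕ → A)
    (n : ℕ) : Matrix ((Fin n × Fin m) ⊕ Fin m) ((Fin n × Fin m) ⊕ Fin m) ℝ :=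
  (lam⁻¹ • kernelMatrix M fun s : Fin (n + 1) => h s).submatrix (roundEquiv n m) (roundEquiv n m)

/-- The likelihood ratio of the first `n` noise vectors `x` under the Gaussian with covariance
`1 + lam⁻¹ K` and the standard Gaussian. -/
noncomputable def noiseRatio (M : A → H →L[ℝ] EuclideanSpace ℝ (Fin m)) (lam : ℝ) (h : ℕ → A)
    (x : ℕ → Fin m → ℝ) (n : ℕ) : ℝ :=
  gaussRatio (1 + lam⁻¹ • kernelMatrix M fun s : Fin n => h s) 0 fun p => x p.1 p.2

lemma smul_kernelMatrix_posSemidef (M : A → H →L[ℝ] EuclideanSpace ℝ (Fin m)) {lam : ℝ}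
    (hlam : 0 < lam) {n : ℕ} (h : Fin n → A) : (lam⁻¹ • kernelMatrix M h).PosSemidef :=
  (kernelMatrix_posSemidef M h).smul (inv_nonneg.2 hlam.le)

lemma splitKernel_posSemidef (M : A → H →L[ℝ] EuclideanSpace ℝ (Fin m)) {lam : ℝ}
    (hlam : 0 < lam) (h : ℕ → A) (n : ℕ) : (splitKernel M lam h n).PosSemidef :=
  (smul_kernelMatrix_posSemidef M hlam _).submatrix _

/-- The mean and covariance in the new factor involve the actions of rounds $0,\dots,n$ but only the
noise before round $n$. They are thus fixed when the conditional bound on $x_n$ is applied. -/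
lemma noiseRatio_succ (M : A → H →L[ℝ] EuclideanSpace ℝ (Fin m)) {lam : ℝ}
    (hlam : 0 < lam) (h : ℕ → A) (x : ℕ → Fin m → ℝ) (n : ℕ) :
    noiseRatio M lam h x (n + 1) = noiseRatio M lam h x n *
      gaussRatio (condCov (splitKernel M lam h n))
        (condMean (splitKernel M lam h n) fun p => x p.1 p.2) (x n) := by
  have e1 : (1 + lam⁻¹ • kernelMatrix M fun s : Fin (n + 1) => h s).submatrix
      (roundEquiv n m) (roundEquiv n m) = 1 + splitKernel M lam h n := by
    rw [Matrix.submatrix_add, Pi.add_apply, Pi.add_apply, Matrix.submatrix_one_equiv]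
    rfl
  have e2 : (fun p : Fin (n + 1) × Fin m => x p.1 p.2) ∘ roundEquiv n m =
      Sum.elim (fun p : Fin n × Fin m => x p.1 p.2) (x n) := by
    ext p
    rcases p with p | j <;> rfl
  rw [noiseRatio, ← gaussRatio_submatrix _ (roundEquiv n m), e1, e2,
    gaussRatio_one_add (splitKernel_posSemidef M hlam h n)]
  rfl

lemma noiseRatio_zero (M : A → H →L[ℝ] EuclideanSpace ℝ (Fin m)) (lam : ℝ) (h : ℕ → A)
    (x : ℕ → Fin m → ℝ) : noiseRatio M lam h x 0 = 1 := by
  simp [noiseRatio, gaussRatio, dotProduct, Matrix.det_isEmpty]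

/-- Take logarithms; the square root of the determinant and the $1/2$ in the exponent account for
the constants, and rescaling the noise for $\rho^2$. -/
lemma noiseForm_le_of_noiseRatio_le (M : A → H →L[ℝ] EuclideanSpace ℝ (Fin m)) {lam ρ δ : ℝ}
    (hlam : 0 < lam) (hρ : 0 < ρ) {n : ℕ} (h : ℕ → A)
    (x : ℕ → EuclideanSpace ℝ (Fin m))
    (hN : noiseRatio M lam h (fun s i => ρ⁻¹ * x s i) n ≤ 1 / δ) :
    noiseForm M lam (fun s : Fin n => h s) (fun p => x p.1 p.2) ≤
      ρ ^ 2 * (2 * Real.log (1 / δ) +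
        Real.log (Matrix.det (1 + lam⁻¹ • kernelMatrix M fun s : Fin n => h s))) := by
  have hdet := (one_add_posDef (smul_kernelMatrix_posSemidef M hlam fun s : Fin n => h s)).det_pos
  have hlog := Real.log_le_log (div_pos (Real.exp_pos _) (Real.sqrt_pos.2 hdet)) hN
  have ex : (fun p : Fin n × Fin m => ρ⁻¹ * x p.1 p.2) = ρ⁻¹ • fun p => x p.1 p.2 := rfl
  rw [sub_zero, ex, Real.log_div (Real.exp_pos _).ne' (Real.sqrt_pos.2 hdet).ne', Real.log_exp,
    Real.log_sqrt hdet.le, Matrix.mulVec_smul, smul_dotProduct, dotProduct_smul, smul_dotProduct,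
    dotProduct_smul, smul_eq_mul, smul_eq_mul, smul_eq_mul, smul_eq_mul, ← mul_sub, ← mul_sub]
    at hlog
  change (ρ⁻¹ * (ρ⁻¹ * noiseForm M lam _ _)) / 2 - _ ≤ _ at hlog
  set q := noiseForm M lam (fun s : Fin n => h s) fun p => x p.1 p.2
  have e : q = ρ ^ 2 * (ρ⁻¹ * (ρ⁻¹ * q)) := by field_simp
  rw [e]
  refine mul_le_mul_of_nonneg_left ?_ (sq_nonneg ρ)
  linarith

lemma measurable_kernelMatrix_entry [MeasurableSpace A] {G : MeasurableSpace Ω}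
    {M : A → H →L[ℝ] EuclideanSpace ℝ (Fin m)}
    (hM : ∀ i j, Measurable fun p : A × A => kM M p.1 p.2 i j) {a : ℕ → Ω → A} {n : ℕ}
    (ha : ∀ s < n, Measurable[G] (a s)) (lam : ℝ) (p q : Fin n × Fin m) :
    Measurable[G] fun ω => (lam⁻¹ • kernelMatrix M fun s : Fin n => a s ω) p q :=
  ((hM p.2 q.2).comp ((ha p.1 p.1.2).prodMk (ha q.1 q.1.2))).const_smul lam⁻¹

lemma measurable_noiseRatio [MeasurableSpace A] {G : MeasurableSpace Ω}
    {M : A → H →L[ℝ] EuclideanSpace ℝ (Fin m)}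
    (hM : ∀ i j, Measurable fun p : A × A => kM M p.1 p.2 i j) {a : ℕ → Ω → A}
    {x : ℕ → Ω → Fin m → ℝ} {n : ℕ} (ha : ∀ s < n, Measurable[G] (a s))
    (hx : ∀ s < n, ∀ i, Measurable[G] fun ω => x s ω i) (lam : ℝ) :
    Measurable[G] fun ω => noiseRatio M lam (fun s => a s ω) (fun s => x s ω) n :=
  measurable_gaussRatio (fun p q => (measurable_kernelMatrix_entry hM ha lam p q).const_add _)
    (fun _ => measurable_const) fun p => hx p.1 p.1.2 p.2

variable [MeasurableSpace A] {m0 : MeasurableSpace Ω} {μ : Measure Ω} [IsProbabilityMeasure μ]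

lemma measure_exists_noiseRatio_gt_le {M : A → H →L[ℝ] EuclideanSpace ℝ (Fin m)}
    (hM : ∀ i j, Measurable fun p : A × A => kM M p.1 p.2 i j) {lam : ℝ} (hlam : 0 < lam)
    {a : ℕ → Ω → A} {y : ℕ → Ω → EuclideanSpace ℝ (Fin m)} {x : ℕ → Ω → Fin m → ℝ}
    (ha : ∀ t, Measurable (a t)) (hy : ∀ t, Measurable (y t))
    (hx : ∀ s n, s < n → ∀ i, Measurable[history a y n] fun ω => x s ω i)
    (hsub : ∀ t, StdSubGaussian μ (historyWithAction a y t) (x t)) {δ : ℝ} (hδ : 0 < δ) :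
    μ {ω | ∃ n, 1 / δ < noiseRatio M lam (fun s => a s ω) (fun s => x s ω) n} ≤
      ENNReal.ofReal δ := by
  have hGle : ∀ n, historyWithAction a y n ≤ m0 := historyWithAction_le ha hy
  have hNm : ∀ n, Measurable[history a y n] fun ω =>
      ENNReal.ofReal (noiseRatio M lam (fun s => a s ω) (fun s => x s ω) n) := fun n =>
    (measurable_noiseRatio hM (fun s hs => measurable_action_history hs)
      (fun s hs => hx s n hs) lam).ennreal_ofReal
  have hville := mul_measure_exists_gt_le (μ := μ) (history_mono (a := a) (y := y))
    (fun n => (history_le_historyWithAction n).trans (hGle n)) hNm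
    (by simp only [noiseRatio_zero]; simp) (fun n s hs => ?_) (ENNReal.ofReal (1 / δ))
  · have hset : {ω | ∃ n, 1 / δ < noiseRatio M lam (fun s => a s ω) (fun s => x s ω) n} =
        {ω | ∃ n, ENNReal.ofReal (1 / δ) <
          ENNReal.ofReal (noiseRatio M lam (fun s => a s ω) (fun s => x s ω) n)} := by
      ext ω
      simp only [Set.mem_ofPred_eq, ENNReal.ofReal_lt_ofReal_iff_of_nonneg (one_div_pos.2 hδ).le]
    rw [hset]
    calc _ = ENNReal.ofReal δ * (ENNReal.ofReal (1 / δ) * _) := by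
          rw [← mul_assoc, ← ENNReal.ofReal_mul hδ.le, mul_one_div_cancel hδ.ne',
            ENNReal.ofReal_one, one_mul]
      _ ≤ ENNReal.ofReal δ * 1 := mul_le_mul_right hville _
      _ = ENNReal.ofReal δ := mul_one _
  -- The filtration in Ville's inequality is the plain history, but the step conditions on the
  -- larger σ-algebra that includes action $n$, on which the new factor depends. The weight is the
  -- current ratio restricted to $s$.
  · have hsm : MeasurableSet[historyWithAction a y n] s := history_le_historyWithAction n s hs
    have hxG : ∀ k < n, ∀ i, Measurable[historyWithAction a y n] fun ω => x k ω i :=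
      fun k hk i => (hx k n hk i).mono (history_le_historyWithAction n) le_rfl
    have hTm : ∀ p q, Measurable[historyWithAction a y n]
        fun ω => splitKernel M lam (fun s => a s ω) n p q := fun p q =>
      measurable_kernelMatrix_entry hM (fun k hk =>
        measurable_action_historyWithAction (Nat.lt_succ_iff.1 hk)) lam _ _
    have hstep := lintegral_mul_gaussRatio_le (μ := μ) (hGle n)
      (fun i => (hx n (n + 1) n.lt_succ_self i).mono
        ((history_le_historyWithAction (n + 1)).trans (hGle (n + 1))) le_rfl) (hsub n)
      (((hNm n).mono (history_le_historyWithAction n) le_rfl).indicator hsm)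
      (measurable_condCov hTm)
      (measurable_condMean (v := fun ω (p : Fin n × Fin m) => x p.1 ω p.2) hTm
        fun p => hxG p.1 p.1.2 p.2)
      fun ω => condCov_sub_one_posSemidef (splitKernel_posSemidef M hlam (fun s => a s ω) n)
    rw [lintegral_indicator (hGle n _ hsm)] at hstep
    rw [← lintegral_indicator (hGle n _ hsm)]
    refine le_of_eq_of_le (lintegral_congr fun ω => ?_) hstep
    by_cases hω : ω ∈ s
    · rw [Set.indicator_of_mem hω, Set.indicator_of_mem hω, noiseRatio_succ M hlam,
        ENNReal.ofReal_mul (p := noiseRatio _ _ _ _ _) (gaussRatio_nonneg _ _ _)]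
    · rw [Set.indicator_of_notMem hω, Set.indicator_of_notMem hω, zero_mul]

/-- With probability at least `1 - δ`, the noise form is bounded in all rounds. -/
lemma measure_forall_noiseForm_le {M : A → H →L[ℝ] EuclideanSpace ℝ (Fin m)}
    (hM : ∀ i j, Measurable fun p : A × A => kM M p.1 p.2 i j) {lam ρ δ : ℝ} (hlam : 0 < lam)
    (hρ : 0 ≤ ρ) (hδ : 0 < δ) {f : H} {a : ℕ → Ω → A}
    {y ε : ℕ → Ω → EuclideanSpace ℝ (Fin m)} (ha : ∀ t, Measurable (a t))
    (hε : ∀ t, Measurable (ε t)) (hy : ∀ t ω, y t ω = M (a t ω) f + ε t ω)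
    (hsub : ∀ t, CondSubGaussian μ (historyWithAction a y t) ρ (ε t)) :
    ENNReal.ofReal (1 - δ) ≤ μ {ω | ∀ n : ℕ,
      noiseForm M lam (fun s : Fin n => a s ω) (fun p => ε p.1 ω p.2) ≤
        ρ ^ 2 * (2 * Real.log (1 / δ) + Real.log (Matrix.det (1 + lam⁻¹ •
          kernelMatrix M fun s : Fin n => a s ω)))} := by
  have hMf : ∀ {G : MeasurableSpace Ω} t, Measurable[G] (a t) →
      Measurable[G] fun ω => M (a t ω) f := fun t hat =>
    ((MeasurableEquiv.toLp 2 (Fin m → ℝ)).measurable.comp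
      (measurable_pi_lambda _ fun i => measurable_feedback hM f i)).comp hat
  have hym : ∀ t, Measurable (y t) := fun t => by
    rw [funext (hy t)]
    exact (hMf t (ha t)).add (hε t)
  have hcoord : ∀ i, Measurable fun v : EuclideanSpace ℝ (Fin m) => v i := fun i =>
    (EuclideanSpace.proj (𝕜 := ℝ) i).continuous.measurable
  rcases hρ.eq_or_lt with rfl | hρ'
  -- For $\rho=0$ the noise cannot be rescaled; almost surely both sides of the bound are zero.
  · have hz : ∀ᵐ ω ∂μ, ∀ t, ε t ω = 0 := ae_all_iff.2 fun t =>
      ae_eq_zero_of_condSubGaussian_zero (historyWithAction_le ha hym t) (hsub t)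
    refine (ENNReal.ofReal_le_one.2 (by linarith)).trans ?_
    rw [← measure_univ (μ := μ)]
    refine measure_mono_ae ?_
    filter_upwards [hz] with ω hω _ n
    simp [noiseForm, hω, dotProduct]
  · have hx : ∀ s n, s < n → ∀ i, Measurable[history a y n] fun ω => ρ⁻¹ * ε s ω i := by
      intro s n hs i
      -- The noise is recovered from the history as observation minus feedback of $f$, which is
      -- where measurability of the feedback is used.
      have e : (fun ω => ρ⁻¹ * ε s ω i) = fun ω => ρ⁻¹ * (y s ω i - M (a s ω) f i) := by
        ext ω
        rw [hy, PiLp.add_apply, add_sub_cancel_left]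
      rw [e]
      exact (((hcoord i).comp (measurable_observation_history hs)).sub
        ((hcoord i).comp (hMf s (measurable_action_history hs)))).const_mul _
    have hbad := measure_exists_noiseRatio_gt_le (x := fun s ω i => ρ⁻¹ * ε s ω i) hM hlam ha hym
      hx (fun t => stdSubGaussian_of_condSubGaussian hρ'.ne' (hsub t)) hδ
    -- The whole space is covered by the good event and the event of exceeding $1/\delta$;
    -- subadditivity of $\mu$ then needs no measurability of the good event.
    rw [ENNReal.ofReal_sub _ hδ.le, ENNReal.ofReal_one, tsub_le_iff_right, ← measure_univ (μ := μ)]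
    refine (measure_mono fun ω _ => ?_).trans ((measure_union_le _ _).trans
      (add_le_add le_rfl hbad))
    by_cases hω : ∃ n, 1 / δ <
        noiseRatio M lam (fun s => a s ω) (fun s i => ρ⁻¹ * ε s ω i) n
    · exact Or.inr hω
    · push Not at hω
      exact Or.inl fun n =>
        noiseForm_le_of_noiseRatio_le M hlam hρ' (fun s => a s ω) (fun s => ε s ω) (hω n)

end NoiseProcess

end KernelPM

theorem mainTheorem12
    {H A Ω : Type*} [NormedAddCommGroup H] [InnerProductSpace ℝ H] [CompleteSpace H]
    [MeasurableSpace A] [MeasurableSpace Ω] (μ : Measure Ω) [IsProbabilityMeasure μ]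
    (m : ℕ) (φ : A → H) (M : A → H →L[ℝ] EuclideanSpace ℝ (Fin m))
    (hM : ∀ i j, Measurable fun p : A × A => KernelPM.kM M p.1 p.2 i j)
    (lam ρ B δ : ℝ) (hlam : 0 < lam) (hρ : 0 ≤ ρ) (hδ : 0 < δ) (hδ1 : δ ≤ 1)
    (fstar : H) (hB : ‖fstar‖ ≤ B)
    (a : ℕ → Ω → A) (y ε : ℕ → Ω → EuclideanSpace ℝ (Fin m))
    (ha : ∀ t, Measurable (a t)) (hε : ∀ t, Measurable (ε t))
    (hy : ∀ t ω, y t ω = M (a t ω) fstar + ε t ω)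
    (hsub : ∀ t, KernelPM.CondSubGaussian μ (KernelPM.historyWithAction a y t) ρ (ε t)) :
    -- `n` is the number of completed rounds; the estimate after `n` rounds uses rounds `0, …, n - 1`
    (ENNReal.ofReal (1 - δ) ≤
      μ {ω | ∀ n : ℕ, fstar ∈ KernelPM.confSet M lam ρ B δ
        (fun s : Fin n => a s ω) (fun s : Fin n => y s ω)}) ∧
    (∀ ω, (∀ n : ℕ, fstar ∈ KernelPM.confSet M lam ρ B δ
        (fun s : Fin n => a s ω) (fun s : Fin n => y s ω)) →
      ∀ (n : ℕ) (b c : A),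
        |KernelPM.reward φ (KernelPM.lsEstimate M lam
              (fun s : Fin n => a s ω) (fun s : Fin n => y s ω)) b
            - KernelPM.reward φ (KernelPM.lsEstimate M lam
              (fun s : Fin n => a s ω) (fun s : Fin n => y s ω)) c
            - (KernelPM.reward φ fstar b - KernelPM.reward φ fstar c)|
          = |⟪φ b - φ c, KernelPM.lsEstimate M lam
              (fun s : Fin n => a s ω) (fun s : Fin n => y s ω) - fstar⟫| ∧
        |⟪φ b - φ c, KernelPM.lsEstimate M lam
              (fun s : Fin n => a s ω) (fun s : Fin n => y s ω) - fstar⟫|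
          ≤ Real.sqrt (KernelPM.beta M lam ρ B δ (fun s : Fin n => a s ω) *
              KernelPM.featureUncertainty φ M lam (fun s : Fin n => a s ω) b c)) ∧
    (ENNReal.ofReal (1 - δ) ≤
      μ {ω | ∀ (n : ℕ) (b c : A),
        |⟪φ b - φ c, KernelPM.lsEstimate M lam
              (fun s : Fin n => a s ω) (fun s : Fin n => y s ω) - fstar⟫|
          ≤ Real.sqrt (KernelPM.beta M lam ρ B δ (fun s : Fin n => a s ω) *
              KernelPM.featureUncertainty φ M lam (fun s : Fin n => a s ω) b c)}) := by
  -- The probability enters only through the noise bound; on that event membership in the confidence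
  -- sets is deterministic.
  have hset : {ω | ∀ n : ℕ, KernelPM.noiseForm M lam (fun s : Fin n => a s ω)
        (fun p => ε p.1 ω p.2) ≤ ρ ^ 2 * (2 * Real.log (1 / δ) + Real.log (Matrix.det (1 + lam⁻¹ •
          KernelPM.kernelMatrix M fun s : Fin n => a s ω)))} ⊆
      {ω | ∀ n : ℕ, fstar ∈ KernelPM.confSet M lam ρ B δ
        (fun s : Fin n => a s ω) (fun s : Fin n => y s ω)} := fun ω hω n => by
    simp only [hy]
    exact KernelPM.mem_confSet_of_noiseForm_le M hlam hρ (fun s : Fin n => a s ω)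
      (fun s : Fin n => ε s ω) hB (hω n)
  have hprob := (KernelPM.measure_forall_noiseForm_le hM hlam hρ hδ ha hε hy hsub).trans
    (measure_mono hset)
  refine ⟨hprob, fun ω hω n b c => ⟨?_, KernelPM.abs_inner_error_le φ M hlam _ _ (hω n) b c⟩,
    hprob.trans (measure_mono fun ω hω n b c =>
      KernelPM.abs_inner_error_le φ M hlam _ _ (hω n) b c)⟩
  congr 1
  simp only [KernelPM.reward, inner_sub_left, inner_sub_right]
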